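/- Let $d,m\in\mathbb N_0$, let $A\in GL(d,\mathbb R)$, $B\in\mathbb R^{d\times m}$, and let $U\subset\mathbb R^m$ be a compact convex neighbourhood of $0$ with $U=\overline{\operatorname{int}U}$. Consider the linear control system $$x_{k+1}=Ax_k+Bu_k,\qquad u_k\in U,\quad k=0,1,2,\dots,$$ put $\mathcal U=U^{\mathbb N_0}$, and let $\varphi(k,x,u)$ denote its solution at time $k$ with initial value $x\in\mathbb R^d$ and control $u=(u_k)_{k\ge0}\in\mathcal U$. Assume that * the system without control restriction (controls with arbitrary values in $\mathbb R^m$) is controllable, i.e. for all $x,y\in\mathbb R^d$ some control steers $x$ to $y$ in some time $k\ge1$; * $A$ is hyperbolic, i.e. no complex eigenvalue $\lambda$ of $A$ satisfies $|\lambda|=1$. *Definitions.* For $x\in\mathbb R^d$ let $\mathbf R(x)=\{\varphi(k,x,u): k\ge1,\ u\in\mathcal U\}$. A control set is a nonvoid set $D\subset\mathbb R^d$ which is maximal with respect to inclusion among the nonvoid sets satisfying (i) $D\subset\overline{\mathbf R(x)}$ for all $x\in D$, and (ii) for every $x\in D$ there is $u\in\mathcal U$ with $\varphi(k,x,u)\in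 D$ for all $k\ge1$. A pair $(K,Q)$ of nonvoid subsets of $\mathbb R^d$ is admissible if $K\subset Q$ is compact and for every $x\in K$ there is $u\in\mathcal U$ with $\varphi(k,x,u)\in Q$ for all $k\ge1$. For $\tau\in\mathbb N$, a set $\mathcal S\subset\mathcal U$ is $(\tau,K,Q)$-spanning if for every $x\in K$ there is $u\in\mathcal S$ with $\varphi(k,x,u)\in Q$ for $k=1,\dots,\tau$. For a continuous function $f:U\to\mathbb R$ (a potential) the invariance pressure is $$P_{inv}(f,K,Q)=\limsup_{\tau\to\infty}\frac1\tau\log\,\inf\Big\{\sum_{u\in\mathcal S}\exp\Big(\sum_{i=0}^{\tau-1}f(u_i)\Big) : \mathcal S\ \text{is}\ (\tau,K,Q)\text{-spanning}\Big\}\in[-\infty,\infty],$$ and the invariance entropy is $$h_{inv}(K,Q)=\limsup_{\tau\to\infty}\frac1\tau\log\,\inf\{\#\mathcal S : \mathcal S\ \text{is}\ (\tau,K,Q)\text{-spanning}\}=P_{inv}(0,K,Q).$$ Finally, $A^+$ is the restriction of $A$ to its unstable subspace $E^u\subset\mathbb R^d$, the sum of the real generalized eigenspaces of $A$ for the eigenvalues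 $\lambda$ with $|\lambda|>1$ (with $\det A^+=1$ if $E^u=0$). **Theorem.** Under these assumptions there exists exactly one control set $D$ with nonvoid interior, and $D$ is bounded. For every compact set $K\subset D$ with nonvoid interior the pair $(K,D)$ is admissible, and for every continuous $f:U\to\mathbb R$ the minimum of $f$ on $U$ exists and $$P_{inv}(f,K,D)=\log|\det A^+|+\min_{u\in U}f(u)=h_{inv}(K,D)+\min_{u\in U}f(u).$$ -/

import Mathlib

open Filter Topology

noncomputable section

namespace DiscreteControl

section General

variable {X Ω : Type*}

/-- The solution `φ(k, x, u)` of `x_{k+1} = F(x_k, u_k)` with initial value `x` and control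
sequence `u`. The type `Ω` is the control range, so `ℕ → Ω` is the set of all admissible
controls. -/
def trajectory (F : X → Ω → X) (x : X) (u : ℕ → Ω) : ℕ → X
  | 0 => x
  | k + 1 => F (trajectory F x u k) (u k)

/-- The reachable set `R(x)`: all points reached from `x` at some time `k ≥ 1`. -/
def reachableSet (F : X → Ω → X) (x : X) : Set X :=
  {y | ∃ k : ℕ, 1 ≤ k ∧ ∃ u : ℕ → Ω, trajectory F x u k = y}

/-- Controllability: every point can be steered to every point. -/
def IsControllable (F : X → Ω → X) : Prop :=
  ∀ x y : X, y ∈ reachableSet F x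

/-- A control set: a nonvoid set which is maximal (for inclusion) with the properties
(i) `D ⊆ closure R(x)` for all `x ∈ D`, and (ii) from every `x ∈ D` some control keeps the
trajectory in `D` for all times `k ≥ 1`. -/
def IsControlSet [TopologicalSpace X] (F : X → Ω → X) (D : Set X) : Prop :=
  Maximal (fun E : Set X =>
    E.Nonempty ∧ (∀ x ∈ E, E ⊆ closure (reachableSet F x)) ∧
      ∀ x ∈ E, ∃ u : ℕ → Ω, ∀ k : ℕ, 1 ≤ k → trajectory F x u k ∈ E) D

/-- Admissible pairs `(K, Q)`. -/
def IsAdmissiblePair [TopologicalSpace X] (F : X → Ω → X) (K Q : Set X) : Prop :=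
  K.Nonempty ∧ Q.Nonempty ∧ K ⊆ Q ∧ IsCompact K ∧
    ∀ x ∈ K, ∃ u : ℕ → Ω, ∀ k : ℕ, 1 ≤ k → trajectory F x u k ∈ Q

/-- `(τ, K, Q)`-spanning sets of controls. -/
def IsSpanning (F : X → Ω → X) (τ : ℕ) (K Q : Set X) (S : Set (ℕ → Ω)) : Prop :=
  ∀ x ∈ K, ∃ u ∈ S, ∀ k : ℕ, 1 ≤ k → k ≤ τ → trajectory F x u k ∈ Q

/-- `a_τ(f, K, Q) = inf { ∑_{u ∈ S} exp (∑_{i<τ} f (u_i)) | S is (τ, K, Q)-spanning }`, as an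
extended nonnegative number (an infinite spanning set may have an infinite sum). -/
def spanningWeight (F : X → Ω → X) (f : Ω → ℝ) (τ : ℕ) (K Q : Set X) : ENNReal :=
  ⨅ (S : Set (ℕ → Ω)) (_ : IsSpanning F τ K Q S),
    ∑' u : S, ENNReal.ofReal (Real.exp (∑ i ∈ Finset.range τ, f ((u : ℕ → Ω) i)))

/-- The invariance pressure `limsup_{τ → ∞} (1/τ) log a_τ(f, K, Q)`, an extended real. -/
def invariancePressure (F : X → Ω → X) (f : Ω → ℝ) (K Q : Set X) : EReal :=
  limsup (fun τ : ℕ => ENNReal.log (spanningWeight F f τ K Q) / (τ : EReal)) atTop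

/-- The minimal cardinality of a `(τ, K, Q)`-spanning set (`⊤` if no finite one exists). -/
def spanningNumber (F : X → Ω → X) (τ : ℕ) (K Q : Set X) : ℕ∞ :=
  ⨅ (S : Set (ℕ → Ω)) (_ : IsSpanning F τ K Q S), S.encard

/-- The invariance entropy: the exponential growth rate, as `τ → ∞`, of the minimal cardinality
of `(τ, K, Q)`-spanning sets. -/
def invarianceEntropy (F : X → Ω → X) (K Q : Set X) : EReal :=
  limsup (fun τ : ℕ => ENNReal.log (spanningNumber F τ K Q : ENNReal) / (τ : EReal)) atTop

end General

section Linear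

/-- The linear system `x_{k+1} = A x_k + B u_k` without control restrictions. -/
def linearSystem {d m : ℕ} (A : Matrix (Fin d) (Fin d) ℝ) (B : Matrix (Fin d) (Fin m) ℝ) :
    (Fin d → ℝ) → (Fin m → ℝ) → (Fin d → ℝ) :=
  fun x u => A.mulVec x + B.mulVec u

/-- The linear system `x_{k+1} = A x_k + B u_k` with control values `u_k ∈ U`. -/
def constrainedLinearSystem {d m : ℕ} (A : Matrix (Fin d) (Fin d) ℝ)
    (B : Matrix (Fin d) (Fin m) ℝ) (U : Set (Fin m → ℝ)) :
    (Fin d → ℝ) → U → (Fin d → ℝ) :=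
  fun x u => linearSystem A B x u

/-- The complex-linear endomorphism of `ℂ^d` given by a real matrix. -/
def complexEnd {d : ℕ} (A : Matrix (Fin d) (Fin d) ℝ) : Module.End ℂ (Fin d → ℂ) :=
  Matrix.toLin' (A.map Complex.ofReal)

/-- No (complex) eigenvalue of `A` has absolute value one. -/
def IsHyperbolic {d : ℕ} (A : Matrix (Fin d) (Fin d) ℝ) : Prop :=
  ∀ z : ℂ, (complexEnd A).HasEigenvalue z → ‖z‖ ≠ 1

/-- The inclusion of `ℝ^d` in `ℂ^d`. -/
def complexify (d : ℕ) : (Fin d → ℝ) →ₗ[ℝ] (Fin d → ℂ) where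
  toFun x := fun i => (x i : ℂ)
  map_add' x y := by ext i; simp
  map_smul' c x := by ext i; simp

/-- The unstable subspace `E^u ⊆ ℝ^d`: the real vectors in the sum of the complex generalized
eigenspaces of `A` for the eigenvalues `z` with `|z| > 1` (that is, the sum of the corresponding
generalized real eigenspaces). -/
def unstableSubspace {d : ℕ} (A : Matrix (Fin d) (Fin d) ℝ) : Submodule ℝ (Fin d → ℝ) :=
  ((⨆ (z : ℂ) (_ : 1 < ‖z‖), (complexEnd A).maxGenEigenspace z).restrictScalars ℝ).comap
    (complexify d)

theorem complexEnd_complexify {d : ℕ} (A : Matrix (Fin d) (Fin d) ℝ) (x : Fin d → ℝ) :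
    complexEnd A (complexify d x) = complexify d (Matrix.toLin' A x) := by
  ext i
  simp [complexEnd, complexify, Matrix.mulVec, dotProduct]

theorem mapsTo_unstableSubspace {d : ℕ} (A : Matrix (Fin d) (Fin d) ℝ) :
    ∀ x ∈ unstableSubspace A, Matrix.toLin' A x ∈ unstableSubspace A := by
  intro x hx
  have key : (⨆ (z : ℂ) (_ : 1 < ‖z‖), (complexEnd A).maxGenEigenspace z) ≤
      (⨆ (z : ℂ) (_ : 1 < ‖z‖), (complexEnd A).maxGenEigenspace z).comap (complexEnd A) := by
    refine iSup₂_le fun z hz v hv => ?_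
    have h1 : complexEnd A v ∈ (complexEnd A).maxGenEigenspace z :=
      Module.End.mapsTo_maxGenEigenspace_of_comm (Commute.refl (complexEnd A)) z hv
    exact (le_iSup₂_of_le (f := fun (z : ℂ) (_ : 1 < ‖z‖) => (complexEnd A).maxGenEigenspace z)
      z hz le_rfl) h1
  have h2 := key hx
  simp only [unstableSubspace, Submodule.mem_comap, Submodule.restrictScalars_mem] at h2 ⊢
  rw [← complexEnd_complexify]
  exact h2

/-- The unstable determinant `det A⁺`, where `A⁺ : E^u → E^u` is the restriction of `A` to the
unstable subspace (its value is `1` if `E^u = 0`). -/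
def unstableDet {d : ℕ} (A : Matrix (Fin d) (Fin d) ℝ) : ℝ :=
  LinearMap.det ((Matrix.toLin' A).restrict (mapsTo_unstableSubspace A))

end Linear

end DiscreteControl

end

/-!
Let `Eu` and `Es` be the unstable and stable subspaces of `A`. Two convex
neighbourhoods of `0` carry the argument: the set `R` of points reachable from `0`
(`reachableFromZero`) and the set `N` of points which can be steered to `0` (`nullControllable`).

The set `D = closure R ∩ N` is a control set (`isControlSet_mainControlSet`). Hyperbolicity enters
through the invariance of `R` under translations by `Eu` and of `N` under translations by `Es`: a
point which can be approximately revisited at late times lies in `closure R ∩ closure N`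
(`mem_closure_of_recurrent`), since its stable part is determined by the control and its unstable
part by the requirement to return. All points of a control set are such points, and convexity of
`N` makes `interior (closure N)` equal to `interior N`; hence `D` is the only control set with
nonvoid interior (`IsControlSet.eq_mainControlSet`). The stable part of `R` and the unstable part of
`N` are bounded, hence so is `D` (`isBounded_mainControlSet`).

For the lower bound of the pressure, project to `Eu`: the points of `K` kept in `D` by one control
are expanded in volume by `|det A⁺|` in each step and stay in a bounded set
(`exists_card_lower_bound`), and each control has weight at least `exp (τ min f)`.

For the upper bound, take a control value `u₀` in the interior of `U` with `f u₀` close to the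
minimum; its equilibrium is an interior point of `D` (`exists_near_optimal_equilibrium`). Over long
time blocks of length `T`, at most `4 ^ dim Eu * |det A⁺| ^ T` controls with values near `u₀` return
every point of a fixed neighbourhood of the equilibrium to this neighbourhood
(`exists_block_controls`); the factor `4 ^ dim Eu` from the covering argument
(`exists_finset_cover_image_ball`) contributes only `dim Eu * log 4 / T` to the growth rate. The
set `K` is steered to this neighbourhood by finitely many controls, and solutions between points of
`D` do not leave `D` (`state_mem_mainControlSet_of_le`), so these controls combine to spanning sets
(`spanningWeight_upper_bound`).
-/

namespace DiscreteControl

/-! ### Hyperbolic splittings -/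

section Splitting

variable {V : Type*} [NormedAddCommGroup V] [NormedSpace ℝ V]

/-- A decomposition `V = Eu ⊕ Es` into `a`-invariant subspaces such that the powers of `a` contract
`Es` and expand `Eu`, both by arbitrarily large factors. Expansion is expressed without an inverse
of `a`, as `‖x‖ ≤ ε ‖aⁿ x‖` on `Eu`. -/
structure IsHyperbolicSplitting (a : V →ₗ[ℝ] V) (Eu Es : Submodule ℝ V) : Prop where
  isCompl : IsCompl Eu Es
  mapsTo_unstable : ∀ x ∈ Eu, a x ∈ Eu
  mapsTo_stable : ∀ x ∈ Es, a x ∈ Es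
  contracts : ∀ ε > 0, ∀ᶠ n : ℕ in atTop, ∀ x ∈ Es, ‖(a ^ n) x‖ ≤ ε * ‖x‖
  expands : ∀ ε > 0, ∀ᶠ n : ℕ in atTop, ∀ x ∈ Eu, ‖x‖ ≤ ε * ‖(a ^ n) x‖

theorem pow_mem_of_mapsTo {a : V →ₗ[ℝ] V} {E : Submodule ℝ V} (h : ∀ x ∈ E, a x ∈ E)
    (n : ℕ) {x : V} (hx : x ∈ E) : (a ^ n) x ∈ E := by
  induction n with
  | zero => simpa using hx
  | succ n ih => rw [pow_succ', Module.End.mul_apply]; exact h _ ih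

end Splitting

/-! ### Decay of generalized eigenvectors -/

section Spectral

theorem tendsto_zero_of_contracting_recursion {v e : ℕ → ℝ} {r : ℝ} (hr0 : 0 ≤ r) (hr : r < 1)
    (hv : ∀ n, 0 ≤ v n) (h : ∀ n, v (n + 1) ≤ r * v n + e n) (he : Tendsto e atTop (𝓝 0)) :
    Tendsto v atTop (𝓝 0) := by
  rw [Metric.tendsto_atTop]
  intro ε hε
  have h1r : 0 < 1 - r := by linarith
  obtain ⟨N, hN⟩ := (Metric.tendsto_atTop.1 he) (ε / 2 * (1 - r)) (by positivity)
  have key : ∀ j, v (N + j) ≤ r ^ j * v N + ε / 2 := by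
    intro j
    induction j with
    | zero => simp; linarith
    | succ j ih =>
      have h1 := h (N + j)
      have h2 := hN (N + j) (by omega)
      rw [Real.dist_eq, sub_zero] at h2
      have h3 := (abs_lt.1 h2).2
      have h4 := mul_le_mul_of_nonneg_left ih hr0
      rw [← add_assoc, pow_succ']
      nlinarith
  have hlim : Tendsto (fun j => r ^ j * v N) atTop (𝓝 0) := by
    simpa using (tendsto_pow_atTop_nhds_zero_of_lt_one hr0 hr).mul_const (v N)
  obtain ⟨J, hJ⟩ := (Metric.tendsto_atTop.1 hlim) (ε / 2) (by positivity)
  refine ⟨N + J, fun n hn => ?_⟩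
  obtain ⟨j, rfl⟩ := Nat.exists_eq_add_of_le (show N ≤ n by omega)
  have h1 := hJ j (by omega)
  rw [Real.dist_eq, sub_zero] at h1 ⊢
  rw [abs_of_nonneg (hv _)]
  have := (abs_lt.1 h1).2
  linarith [key j]

variable {C : Type*} [NormedAddCommGroup C] [NormedSpace ℂ C]

/-- The vectors whose orbit under `f` tends to `0`. -/
noncomputable def decaySubspace (f : Module.End ℂ C) : Submodule ℂ C where
  carrier := {x | Tendsto (fun n : ℕ => (f ^ n) x) atTop (𝓝 0)}
  zero_mem' := by simp
  add_mem' := by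
    intro x y hx hy
    simpa using hx.add hy
  smul_mem' := by
    intro c x hx
    simpa using hx.const_smul c

theorem mem_decaySubspace {f : Module.End ℂ C} {x : C} :
    x ∈ decaySubspace f ↔ Tendsto (fun n : ℕ => (f ^ n) x) atTop (𝓝 0) := Iff.rfl

/-- The orbits of `x` and of `y = (f - z) x` satisfy `fⁿ⁺¹ x = z fⁿ x + fⁿ y`, so decay passes from
`y` to `x` when `|z| < 1`. Induction on the nilpotency order then covers generalized eigenvectors. -/
theorem mem_decaySubspace_of_sub_smul {f : Module.End ℂ C} {z : ℂ} (hz : ‖z‖ < 1) {x : C}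
    (hx : (f - algebraMap ℂ _ z) x ∈ decaySubspace f) : x ∈ decaySubspace f := by
  rw [mem_decaySubspace, tendsto_zero_iff_norm_tendsto_zero] at hx ⊢
  refine tendsto_zero_of_contracting_recursion (norm_nonneg z) hz (fun n => norm_nonneg _)
    (fun n => ?_) hx
  have : (f ^ (n + 1)) x = z • (f ^ n) x + (f ^ n) ((f - algebraMap ℂ _ z) x) := by
    simp [pow_succ, Module.End.mul_apply]
  rw [this, ← norm_smul]
  exact norm_add_le _ _

theorem mem_decaySubspace_of_pow {f : Module.End ℂ C} {z : ℂ} (hz : ‖z‖ < 1) (k : ℕ) {x : C}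
    (hx : ((f - algebraMap ℂ _ z) ^ k) x = 0) : x ∈ decaySubspace f := by
  induction k generalizing x with
  | zero =>
    obtain rfl : x = 0 := by simpa using hx
    exact zero_mem _
  | succ k ih =>
    refine mem_decaySubspace_of_sub_smul hz (ih ?_)
    rwa [pow_succ, Module.End.mul_apply] at hx

theorem maxGenEigenspace_le_decaySubspace (f : Module.End ℂ C) {z : ℂ} (hz : ‖z‖ < 1) :
    f.maxGenEigenspace z ≤ decaySubspace f := by
  intro x hx
  obtain ⟨k, hk⟩ := (Module.End.mem_maxGenEigenspace f z x).1 hx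
  exact mem_decaySubspace_of_pow hz k hk

/-- A generalized eigenvector of `f` for `z` is one of `f⁻¹` for `z⁻¹`, because
`f⁻¹ - z⁻¹ = -z⁻¹ f⁻¹ (f - z)`. -/
theorem maxGenEigenspace_le_decaySubspace_inv {f g : Module.End ℂ C} (hgf : g * f = 1)
    (hfg : f * g = 1) {z : ℂ} (hz : 1 < ‖z‖) :
    f.maxGenEigenspace z ≤ decaySubspace g := by
  intro x hx
  obtain ⟨k, hk⟩ := (Module.End.mem_maxGenEigenspace f z x).1 hx
  have hz0 : z ≠ 0 := by
    rintro rfl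
    norm_num at hz
  have hz' : ‖z⁻¹‖ < 1 := by
    rw [norm_inv]
    exact inv_lt_one_of_one_lt₀ hz
  refine mem_decaySubspace_of_pow hz' k ?_
  have h1 : g - algebraMap ℂ _ z⁻¹ = (-z⁻¹) • (g * (f - z • 1)) := by
    rw [mul_sub, hgf, smul_sub, mul_smul_comm, mul_one, smul_smul, Algebra.algebraMap_eq_smul_one]
    rw [neg_mul, inv_mul_cancel₀ hz0]
    module
  have hcomm : Commute g (f - z • 1) := by
    refine Commute.sub_right ?_ ?_
    · exact hgf.trans hfg.symm
    · exact (Commute.one_right g).smul_right z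
  rw [h1, smul_pow, hcomm.mul_pow, LinearMap.smul_apply, Module.End.mul_apply, hk]
  simp

end Spectral

/-! ### The splitting of a hyperbolic matrix -/

section Matrices

variable {d : ℕ}

/-- The stable subspace `E^s ⊆ ℝ^d`: the real vectors in the sum of the complex generalized
eigenspaces of `A` for the eigenvalues `z` with `|z| < 1`. -/
noncomputable def stableSubspace (A : Matrix (Fin d) (Fin d) ℝ) : Submodule ℝ (Fin d → ℝ) :=
  ((⨆ (z : ℂ) (_ : ‖z‖ < 1), (complexEnd A).maxGenEigenspace z).restrictScalars ℝ).comap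
    (complexify d)

theorem mapsTo_stableSubspace (A : Matrix (Fin d) (Fin d) ℝ) :
    ∀ x ∈ stableSubspace A, Matrix.toLin' A x ∈ stableSubspace A := by
  intro x hx
  have key : (⨆ (z : ℂ) (_ : ‖z‖ < 1), (complexEnd A).maxGenEigenspace z) ≤
      (⨆ (z : ℂ) (_ : ‖z‖ < 1), (complexEnd A).maxGenEigenspace z).comap (complexEnd A) :=
    iSup₂_le fun z hz v hv => le_iSup₂_of_le
      (f := fun (z : ℂ) (_ : ‖z‖ < 1) => (complexEnd A).maxGenEigenspace z) z hz le_rfl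
      (Module.End.mapsTo_maxGenEigenspace_of_comm (Commute.refl (complexEnd A)) z hv)
  have h2 := key hx
  simp only [stableSubspace, Submodule.mem_comap, Submodule.restrictScalars_mem] at h2 ⊢
  rwa [← complexEnd_complexify]

/-- Componentwise complex conjugation, as a semilinear map. -/
noncomputable def conjVec (d : ℕ) : (Fin d → ℂ) →ₛₗ[starRingEnd ℂ] (Fin d → ℂ) where
  toFun w := fun i => starRingEnd ℂ (w i)
  map_add' x y := by ext i; simp
  map_smul' c x := by ext i; simp

theorem complexEnd_conjVec (A : Matrix (Fin d) (Fin d) ℝ) (w : Fin d → ℂ) :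
    complexEnd A (conjVec d w) = conjVec d (complexEnd A w) := by
  ext i
  simp [complexEnd, conjVec, Matrix.mulVec, dotProduct]

theorem conjVec_mem_maxGenEigenspace {A : Matrix (Fin d) (Fin d) ℝ} {z : ℂ} {w : Fin d → ℂ}
    (hw : w ∈ (complexEnd A).maxGenEigenspace z) :
    conjVec d w ∈ (complexEnd A).maxGenEigenspace (starRingEnd ℂ z) := by
  obtain ⟨k, hk⟩ := (Module.End.mem_maxGenEigenspace _ _ _).1 hw
  refine (Module.End.mem_maxGenEigenspace _ _ _).2 ⟨k, ?_⟩
  have : ∀ (k : ℕ) (w : Fin d → ℂ), ((complexEnd A - starRingEnd ℂ z • 1) ^ k) (conjVec d w)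
      = conjVec d (((complexEnd A - z • 1) ^ k) w) := by
    intro k
    induction k with
    | zero => intro w; simp
    | succ k ih =>
      intro w
      rw [pow_succ, pow_succ, Module.End.mul_apply, Module.End.mul_apply, ← ih]
      congr 1
      simp only [LinearMap.sub_apply, LinearMap.smul_apply, Module.End.one_apply, map_sub,
        complexEnd_conjVec, LinearMap.map_smulₛₗ]
  rw [this, hk, map_zero]

theorem conjVec_mem_iSup {A : Matrix (Fin d) (Fin d) ℝ} {p : ℝ → Prop} {w : Fin d → ℂ}
    (hw : w ∈ ⨆ (z : ℂ) (_ : p ‖z‖), (complexEnd A).maxGenEigenspace z) :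
    conjVec d w ∈ ⨆ (z : ℂ) (_ : p ‖z‖), (complexEnd A).maxGenEigenspace z := by
  have key : (⨆ (z : ℂ) (_ : p ‖z‖), (complexEnd A).maxGenEigenspace z) ≤
      (⨆ (z : ℂ) (_ : p ‖z‖), (complexEnd A).maxGenEigenspace z).comap (conjVec d) :=
    iSup₂_le fun z hz v hv => le_iSup₂_of_le
      (f := fun (z : ℂ) (_ : p ‖z‖) => (complexEnd A).maxGenEigenspace z) (starRingEnd ℂ z)
      (by rwa [RCLike.norm_conj]) le_rfl (conjVec_mem_maxGenEigenspace hv)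
  exact key hw

/-- Sums of generalized eigenspaces over a set of eigenvalues described by the absolute value are
stable under conjugation, hence contain the real parts of their elements. This makes the complex
spectral decomposition descend to `ℝ^d`. -/
theorem complexify_re_mem_iSup {A : Matrix (Fin d) (Fin d) ℝ} {p : ℝ → Prop} {w : Fin d → ℂ}
    (hw : w ∈ ⨆ (z : ℂ) (_ : p ‖z‖), (complexEnd A).maxGenEigenspace z) :
    complexify d (fun i => (w i).re) ∈
      ⨆ (z : ℂ) (_ : p ‖z‖), (complexEnd A).maxGenEigenspace z := by
  have : complexify d (fun i => (w i).re) = (2⁻¹ : ℂ) • (w + conjVec d w) := by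
    ext i
    simp only [complexify, conjVec, LinearMap.coe_mk, AddHom.coe_mk, Pi.smul_apply, Pi.add_apply,
      Complex.add_conj, smul_eq_mul]
    push_cast
    ring
  rw [this]
  exact Submodule.smul_mem _ _ (add_mem hw (conjVec_mem_iSup hw))

theorem complexify_injective (d : ℕ) : Function.Injective (complexify d) := by
  intro x y h
  ext i
  have := congrFun h i
  simpa [complexify] using this

theorem isCompl_unstable_stable_complex {A : Matrix (Fin d) (Fin d) ℝ} (hA : IsHyperbolic A) :
    IsCompl (⨆ (z : ℂ) (_ : 1 < ‖z‖), (complexEnd A).maxGenEigenspace z)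
      (⨆ (z : ℂ) (_ : ‖z‖ < 1), (complexEnd A).maxGenEigenspace z) := by
  constructor
  · have := (Module.End.independent_maxGenEigenspace (complexEnd A)).disjoint_biSup_biSup
      (s := {z : ℂ | 1 < ‖z‖}) (t := {z : ℂ | ‖z‖ < 1})
      (Set.disjoint_left.2 fun z h1 h2 => lt_asymm (Set.mem_ofPred.1 h1) h2)
    simpa using this
  · rw [codisjoint_iff, eq_top_iff, ← Module.End.iSup_maxGenEigenspace_eq_top (complexEnd A)]
    refine iSup_le fun z => ?_
    rcases lt_trichotomy ‖z‖ 1 with h | h | h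
    · exact le_sup_of_le_right (le_iSup₂_of_le
        (f := fun (z : ℂ) (_ : ‖z‖ < 1) => (complexEnd A).maxGenEigenspace z) z h le_rfl)
    · have : (complexEnd A).maxGenEigenspace z = ⊥ := by
        by_contra hne
        refine hA z ?_ h
        obtain ⟨x, hx, hx0⟩ := Submodule.exists_mem_ne_zero_of_ne_bot hne
        obtain ⟨k, hk⟩ := (Module.End.mem_maxGenEigenspace _ _ _).1 hx
        refine Module.End.hasEigenvalue_of_hasGenEigenvalue (k := k) ?_
        intro hbot
        refine hx0 ?_
        have : x ∈ (complexEnd A).genEigenspace z k :=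
          (Module.End.mem_genEigenspace_nat).2 hk
        rw [hbot] at this
        simpa using this
      rw [this]
      exact bot_le
    · exact le_sup_of_le_left (le_iSup₂_of_le
        (f := fun (z : ℂ) (_ : 1 < ‖z‖) => (complexEnd A).maxGenEigenspace z) z h le_rfl)

theorem isCompl_unstableSubspace_stableSubspace {A : Matrix (Fin d) (Fin d) ℝ}
    (hA : IsHyperbolic A) : IsCompl (unstableSubspace A) (stableSubspace A) := by
  have hC := isCompl_unstable_stable_complex hA
  constructor
  · rw [Submodule.disjoint_def]
    intro x hu hs
    have : complexify d x = 0 := Submodule.disjoint_def.1 hC.disjoint _ hu hs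
    exact complexify_injective d (by rw [this, map_zero])
  · rw [codisjoint_iff, eq_top_iff]
    intro x _
    have hx : complexify d x ∈ (⊤ : Submodule ℂ (Fin d → ℂ)) := trivial
    rw [← codisjoint_iff.1 hC.codisjoint] at hx
    obtain ⟨u, hu, s, hs, hus⟩ := Submodule.mem_sup.1 hx
    have hsum : x = (fun i => (u i).re) + (fun i => (s i).re) := by
      ext i
      have := congrArg Complex.re (congrFun hus i)
      simpa [complexify] using this.symm
    rw [hsum]
    exact Submodule.add_mem_sup (complexify_re_mem_iSup (p := fun r => 1 < r) hu)
      (complexify_re_mem_iSup (p := fun r => r < 1) hs)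

theorem complexEnd_pow_complexify (A : Matrix (Fin d) (Fin d) ℝ) (n : ℕ) (x : Fin d → ℝ) :
    (complexEnd A ^ n) (complexify d x) = complexify d ((Matrix.toLin' A ^ n) x) := by
  induction n generalizing x with
  | zero => simp
  | succ n ih =>
    rw [pow_succ, pow_succ, Module.End.mul_apply, Module.End.mul_apply, complexEnd_complexify, ih]

theorem tendsto_pow_of_complexify_mem {A : Matrix (Fin d) (Fin d) ℝ} {x : Fin d → ℝ}
    (hx : complexify d x ∈ decaySubspace (complexEnd A)) :
    Tendsto (fun n : ℕ => (Matrix.toLin' A ^ n) x) atTop (𝓝 0) := by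
  rw [mem_decaySubspace] at hx
  rw [tendsto_pi_nhds] at hx ⊢
  intro i
  have h := (Complex.continuous_re.tendsto _).comp (hx i)
  simp only [Function.comp_def, complexEnd_pow_complexify] at h
  simpa [complexify] using h

/-- In finite dimension pointwise convergence to `0` of linear maps is uniform on bounded sets. -/
theorem eventually_norm_le_of_tendsto {g : ℕ → (Fin d → ℝ) →ₗ[ℝ] (Fin d → ℝ)}
    (hg : ∀ x, Tendsto (fun n => g n x) atTop (𝓝 0)) {ε : ℝ} (hε : 0 < ε) :
    ∀ᶠ n in atTop, ∀ x, ‖g n x‖ ≤ ε * ‖x‖ := by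
  have hsum : Tendsto (fun n => ∑ i : Fin d, ‖g n (Pi.single i 1)‖) atTop (𝓝 0) := by
    simpa using tendsto_finsetSum Finset.univ fun i _ => (hg (Pi.single i 1)).norm
  filter_upwards [hsum.eventually (gt_mem_nhds hε)] with n hn x
  have hx : g n x = ∑ i, x i • g n (Pi.single i 1) := by
    conv_lhs => rw [pi_eq_sum_univ' x, map_sum]
    simp only [map_smul]
  calc ‖g n x‖ ≤ ∑ i, ‖x i • g n (Pi.single i 1)‖ := hx ▸ norm_sum_le _ _
    _ ≤ ∑ i, ‖g n (Pi.single i 1)‖ * ‖x‖ := by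
        refine Finset.sum_le_sum fun i _ => ?_
        rw [norm_smul, mul_comm]
        exact mul_le_mul_of_nonneg_left (norm_le_pi_norm x i) (norm_nonneg _)
    _ = (∑ i, ‖g n (Pi.single i 1)‖) * ‖x‖ := by rw [Finset.sum_mul]
    _ ≤ ε * ‖x‖ := mul_le_mul_of_nonneg_right hn.le (norm_nonneg _)

theorem eventually_norm_pow_le {a : (Fin d → ℝ) →ₗ[ℝ] (Fin d → ℝ)}
    {E F : Submodule ℝ (Fin d → ℝ)} (hEF : IsCompl E F)
    (ha : ∀ x ∈ E, Tendsto (fun n : ℕ => (a ^ n) x) atTop (𝓝 0)) {ε : ℝ} (hε : 0 < ε) :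
    ∀ᶠ n : ℕ in atTop, ∀ x ∈ E, ‖(a ^ n) x‖ ≤ ε * ‖x‖ := by
  have := eventually_norm_le_of_tendsto (g := fun n => (a ^ n) ∘ₗ E.projection F hEF)
    (fun x => ha _ (Submodule.projection_apply_mem hEF x)) hε
  filter_upwards [this] with n hn x hx
  simpa [Submodule.projection_apply_of_mem_left hEF hx] using hn x

theorem isHyperbolicSplitting {A : Matrix (Fin d) (Fin d) ℝ} (hA : IsUnit A)
    (hhyp : IsHyperbolic A) :
    IsHyperbolicSplitting (Matrix.toLin' A) (unstableSubspace A) (stableSubspace A) := by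
  have hdet : IsUnit A.det := (Matrix.isUnit_iff_isUnit_det A).1 hA
  have hcompl := isCompl_unstableSubspace_stableSubspace hhyp
  refine ⟨hcompl, mapsTo_unstableSubspace A, mapsTo_stableSubspace A, fun ε hε => ?_,
    fun ε hε => ?_⟩
  · refine eventually_norm_pow_le hcompl.symm (fun x hx => tendsto_pow_of_complexify_mem ?_) hε
    exact (iSup₂_le fun z hz => maxGenEigenspace_le_decaySubspace _ hz :
      (⨆ (z : ℂ) (_ : ‖z‖ < 1), (complexEnd A).maxGenEigenspace z) ≤ _) hx
  · have hinv : ∀ B C : Matrix (Fin d) (Fin d) ℝ, B * C = 1 →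
        complexEnd B * complexEnd C = 1 := by
      intro B C h
      have hmap : B.map Complex.ofReal * C.map Complex.ofReal = 1 := by
        have := (Matrix.map_mul (L := B) (M := C) (f := Complex.ofRealHom)).symm
        rw [h, Matrix.map_one _ (map_zero _) (map_one _)] at this
        exact this
      rw [complexEnd, complexEnd, Module.End.mul_eq_comp, ← Matrix.toLin'_mul, hmap,
        Matrix.toLin'_one, Module.End.one_eq_id]
    have h1 := hinv _ _ (Matrix.nonsing_inv_mul A hdet)
    have h2 := hinv _ _ (Matrix.mul_nonsing_inv A hdet)
    have hdec := eventually_norm_pow_le (a := Matrix.toLin' A⁻¹) hcompl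
      (fun x hx => tendsto_pow_of_complexify_mem
        ((iSup₂_le fun z hz => maxGenEigenspace_le_decaySubspace_inv h1 h2 hz :
          (⨆ (z : ℂ) (_ : 1 < ‖z‖), (complexEnd A).maxGenEigenspace z) ≤ _) hx)) hε
    filter_upwards [hdec] with n hn x hx
    have h3 : Matrix.toLin' A⁻¹ * Matrix.toLin' A = 1 := by
      rw [Module.End.mul_eq_comp, ← Matrix.toLin'_mul, Matrix.nonsing_inv_mul A hdet]
      simp [Module.End.one_eq_id]
    have h4 : Matrix.toLin' A * Matrix.toLin' A⁻¹ = 1 := by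
      rw [Module.End.mul_eq_comp, ← Matrix.toLin'_mul, Matrix.mul_nonsing_inv A hdet]
      simp [Module.End.one_eq_id]
    have hcomm : Commute (Matrix.toLin' A⁻¹) (Matrix.toLin' A) := h3.trans h4.symm
    have h5 : (Matrix.toLin' A⁻¹ ^ n) ((Matrix.toLin' A ^ n) x) = x := by
      rw [← Module.End.mul_apply, ← hcomm.mul_pow, h3, one_pow, Module.End.one_apply]
    have := hn _ (pow_mem_of_mapsTo (mapsTo_unstableSubspace A) n hx)
    rwa [h5] at this

/-- As `1` is not an eigenvalue, `I - A` is invertible and every constant input has an equilibrium. -/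
theorem exists_equilibrium {A : Matrix (Fin d) (Fin d) ℝ} (hhyp : IsHyperbolic A)
    (y : Fin d → ℝ) : ∃ x, Matrix.toLin' A x + y = x := by
  have hinj : Function.Injective
      ((LinearMap.id : (Fin d → ℝ) →ₗ[ℝ] (Fin d → ℝ)) - Matrix.toLin' A) := by
    rw [← LinearMap.ker_eq_bot, LinearMap.ker_eq_bot']
    intro x hx
    by_contra hx0
    have hfix : Matrix.toLin' A x = x := by
      rw [LinearMap.sub_apply, LinearMap.id_apply, sub_eq_zero] at hx
      exact hx.symm
    refine hhyp 1 (Module.End.hasEigenvalue_of_hasEigenvector (x := complexify d x) ⟨?_, ?_⟩)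
      (by simp)
    · rw [Module.End.mem_eigenspace_iff, complexEnd_complexify, hfix, one_smul]
    · exact fun h => hx0 (complexify_injective d (by rw [h, map_zero]))
  obtain ⟨x, hx⟩ := LinearMap.surjective_of_injective hinj y
  refine ⟨x, ?_⟩
  rw [← hx]
  simp

end Matrices

/-! ### Linear control systems: reachable and null-controllable points -/

section Concat

variable {W : Type*} {U : Set W}

/-- The control which follows `u` up to time `k` and then `v` from its beginning. -/
def concat (k : ℕ) (u v : ℕ → W) : ℕ → W := fun i => if i < k then u i else v (i - k)

theorem concat_mem {k : ℕ} {u v : ℕ → W} (hu : ∀ i, u i ∈ U) (hv : ∀ i, v i ∈ U) (i : ℕ) :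
    concat k u v i ∈ U := by
  unfold concat
  split_ifs
  exacts [hu i, hv _]

end Concat

section Steering

variable {V W : Type*} [NormedAddCommGroup V] [NormedSpace ℝ V]
  [NormedAddCommGroup W] [NormedSpace ℝ W]

/-- The state `φ(k, 0, u)` of `x_{k+1} = a x_k + b u_k` started at `0`, as a linear map of the control
`u`. The solution from `x` is `aᵏ x + steer a b k u`. -/
noncomputable def steer (a : V →ₗ[ℝ] V) (b : W →ₗ[ℝ] V) : ℕ → (ℕ → W) →ₗ[ℝ] V
  | 0 => 0
  | k + 1 => a ∘ₗ steer a b k + b ∘ₗ LinearMap.proj k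

variable {a : V →ₗ[ℝ] V} {b : W →ₗ[ℝ] V} {U : Set W}

@[simp]
theorem steer_zero (u : ℕ → W) : steer a b 0 u = 0 := rfl

theorem steer_succ (k : ℕ) (u : ℕ → W) : steer a b (k + 1) u = a (steer a b k u) + b (u k) := rfl

theorem pow_succ_apply' (k : ℕ) (x : V) : (a ^ (k + 1)) x = a ((a ^ k) x) := by
  rw [pow_succ', Module.End.mul_apply]

theorem steer_congr {k : ℕ} {u v : ℕ → W} (h : ∀ i < k, u i = v i) :
    steer a b k u = steer a b k v := by
  induction k with
  | zero => rfl
  | succ k ih =>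
    rw [steer_succ, steer_succ, ih fun i hi => h i (by omega), h k (by omega)]

theorem steer_eq_zero {k : ℕ} {u : ℕ → W} (h : ∀ i < k, u i = 0) : steer a b k u = 0 := by
  rw [steer_congr (v := 0) h, map_zero]

theorem steer_concat (k j : ℕ) (u v : ℕ → W) :
    steer a b (k + j) (concat k u v) = (a ^ j) (steer a b k u) + steer a b j v := by
  induction j with
  | zero => simpa using steer_congr (v := u) fun i hi => show concat k u v i = u i from if_pos hi
  | succ j ih =>
    rw [← add_assoc, steer_succ, ih, steer_succ, pow_succ_apply', map_add, add_assoc]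
    simp [concat]

theorem state_concat (k j : ℕ) (x : V) (u v : ℕ → W) :
    (a ^ (k + j)) x + steer a b (k + j) (concat k u v)
      = (a ^ j) ((a ^ k) x + steer a b k u) + steer a b j v := by
  rw [steer_concat, map_add, add_comm k j, pow_add, Module.End.mul_apply, add_assoc]

theorem state_split (k j : ℕ) (x : V) (u : ℕ → W) :
    (a ^ (k + j)) x + steer a b (k + j) u
      = (a ^ j) ((a ^ k) x + steer a b k u) + steer a b j (fun i => u (k + i)) := by
  rw [← state_concat]
  congr 1
  refine steer_congr fun i _ => ?_
  unfold concat
  split_ifs with h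
  · rfl
  · congr 1
    omega

/-- Waiting at `0` before applying `u` reaches the same point at a later time. -/
theorem exists_steer_eq_of_le {N k : ℕ} (h : k ≤ N) (u : ℕ → W) :
    steer a b N (concat (N - k) 0 u) = steer a b k u := by
  obtain ⟨j, rfl⟩ := Nat.exists_eq_add_of_le h
  have := steer_concat (a := a) (b := b) j k 0 u
  rw [map_zero, map_zero, zero_add] at this
  rw [show k + j - k = j by omega, add_comm k j, this]

/-- The ranges of the maps `steer a b k` increase with `k`, so in finite dimension controllability
already holds in one fixed time. -/
theorem exists_steer_surjective [FiniteDimensional ℝ V] (hc : ∀ y, ∃ k u, steer a b k u = y) :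
    ∃ N, Function.Surjective (steer a b N) := by
  have hmono : Monotone fun k => LinearMap.range (steer a b k) := by
    intro k N h
    rintro _ ⟨u, rfl⟩
    exact ⟨_, exists_steer_eq_of_le h u⟩
  obtain ⟨N, hN⟩ := (monotone_stabilizes_iff_noetherian (R := ℝ) (M := V)).2 inferInstance
    ⟨_, hmono⟩
  refine ⟨N, fun y => ?_⟩
  obtain ⟨k, u, rfl⟩ := hc y
  have h1 : steer a b k u ∈ LinearMap.range (steer a b (max N k)) :=
    hmono (le_max_right N k) ⟨u, rfl⟩
  have h2 := hN (max N k) (le_max_left _ _)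
  simp only [OrderHom.coe_mk] at h2
  rw [← h2] at h1
  exact h1

theorem exists_bound_linearMap [FiniteDimensional ℝ V] {Y : Type*} [NormedAddCommGroup Y]
    [NormedSpace ℝ Y] (g : V →ₗ[ℝ] Y) : ∃ M, 0 ≤ M ∧ ∀ x, ‖g x‖ ≤ M * ‖x‖ :=
  ⟨‖LinearMap.toContinuousLinearMap g‖, norm_nonneg _,
    fun x => (LinearMap.toContinuousLinearMap g).le_opNorm x⟩

/-- Any point is reached from `0` at a fixed time `N` by a control which is bounded by a multiple of
the norm of the point and vanishes from time `N` on. -/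
theorem exists_bounded_steering [FiniteDimensional ℝ V] (hc : ∀ y, ∃ k u, steer a b k u = y) :
    ∃ N κ, 0 ≤ κ ∧ ∀ y, ∃ w : ℕ → W, steer a b N w = y ∧ (∀ i, ‖w i‖ ≤ κ * ‖y‖) ∧
      ∀ i, N ≤ i → w i = 0 := by
  obtain ⟨N, hN⟩ := exists_steer_surjective hc
  obtain ⟨g, hg⟩ := (steer a b N).exists_rightInverse_of_surjective (LinearMap.range_eq_top.2 hN)
  choose M hM0 hM using fun i => exists_bound_linearMap ((LinearMap.proj i : (ℕ → W) →ₗ[ℝ] W) ∘ₗ g)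
  refine ⟨N, ∑ i ∈ Finset.range N, M i, Finset.sum_nonneg fun i _ => hM0 i, fun y =>
    ⟨fun i => if i < N then g y i else 0, ?_, fun i => ?_, fun i hi => if_neg (by omega)⟩⟩
  · rw [steer_congr (v := g y) fun i hi => if_pos hi]
    exact LinearMap.congr_fun hg y
  · have hsum : 0 ≤ ∑ i ∈ Finset.range N, M i := Finset.sum_nonneg fun i _ => hM0 i
    dsimp only
    split_ifs with h
    · refine (hM i y).trans (mul_le_mul_of_nonneg_right ?_ (norm_nonneg y))
      exact Finset.single_le_sum (fun i _ => hM0 i) (Finset.mem_range.2 h)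
    · rw [norm_zero]
      positivity

theorem exists_local_steering [FiniteDimensional ℝ V] (hc : ∀ y, ∃ k u, steer a b k u = y)
    (hU : U ∈ 𝓝 0) :
    ∃ N, ∀ᶠ y in 𝓝 (0 : V), ∃ w : ℕ → W, (∀ i, w i ∈ U) ∧ steer a b N w = y := by
  obtain ⟨N, κ, hκ, h⟩ := exists_bounded_steering hc
  obtain ⟨δ, hδ, hball⟩ := Metric.mem_nhds_iff.1 hU
  refine ⟨N, ?_⟩
  have hlim : Tendsto (fun y : V => κ * ‖y‖) (𝓝 0) (𝓝 0) := by
    have : Continuous fun y : V => κ * ‖y‖ := by fun_prop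
    simpa using this.tendsto 0
  filter_upwards [hlim.eventually (gt_mem_nhds hδ)] with y hy
  obtain ⟨w, hw, hwn, -⟩ := h y
  exact ⟨w, fun i => hball (mem_ball_zero_iff.2 ((hwn i).trans_lt hy)), hw⟩

/-- The points reached from `0` by controls with values in `U`, at some time `k ≥ 0`. For `0 ∈ U`
admitting `k = 0` changes nothing, since `0` is then reached at every time. -/
def reachableFromZero (a : V →ₗ[ℝ] V) (b : W →ₗ[ℝ] V) (U : Set W) : Set V :=
  {y | ∃ k u, (∀ i, u i ∈ U) ∧ steer a b k u = y}

/-- The points which some control with values in `U` steers to `0`, at some time `k ≥ 0`. -/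
def nullControllable (a : V →ₗ[ℝ] V) (b : W →ₗ[ℝ] V) (U : Set W) : Set V :=
  {x | ∃ k u, (∀ i, u i ∈ U) ∧ (a ^ k) x + steer a b k u = 0}

theorem zero_mem_reachableFromZero (h0 : (0 : W) ∈ U) : 0 ∈ reachableFromZero a b U :=
  ⟨0, 0, fun _ => h0, rfl⟩

theorem zero_mem_nullControllable (h0 : (0 : W) ∈ U) : 0 ∈ nullControllable a b U :=
  ⟨0, 0, fun _ => h0, by simp⟩

theorem reachableFromZero_mem_nhds [FiniteDimensional ℝ V]
    (hc : ∀ y, ∃ k u, steer a b k u = y) (hU : U ∈ 𝓝 0) : reachableFromZero a b U ∈ 𝓝 0 := by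
  obtain ⟨N, hN⟩ := exists_local_steering hc hU
  filter_upwards [hN] with y hy
  obtain ⟨w, hw, h⟩ := hy
  exact ⟨N, w, hw, h⟩

theorem nullControllable_mem_nhds [FiniteDimensional ℝ V]
    (hc : ∀ y, ∃ k u, steer a b k u = y) (hU : U ∈ 𝓝 0) : nullControllable a b U ∈ 𝓝 0 := by
  obtain ⟨N, hN⟩ := exists_local_steering hc hU
  have hlim : Tendsto (fun x : V => -((a ^ N) x)) (𝓝 0) (𝓝 0) := by
    have : Continuous fun x : V => -((a ^ N) x) :=
      (LinearMap.continuous_of_finiteDimensional (a ^ N)).neg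
    simpa using this.tendsto 0
  filter_upwards [hlim.eventually hN] with x hx
  obtain ⟨w, hw, h⟩ := hx
  exact ⟨N, w, hw, by rw [h, add_neg_cancel]⟩

theorem reachableFromZero_at_time_ge (h0 : (0 : W) ∈ U) {y : V}
    (hy : y ∈ reachableFromZero a b U) :
    ∃ k, ∀ N ≥ k, ∃ u : ℕ → W, (∀ i, u i ∈ U) ∧ steer a b N u = y := by
  obtain ⟨k, u, hu, rfl⟩ := hy
  exact ⟨k, fun N hN => ⟨_, concat_mem (fun _ => h0) hu, exists_steer_eq_of_le hN u⟩⟩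

theorem nullControllable_at_time_ge (h0 : (0 : W) ∈ U) {x : V}
    (hx : x ∈ nullControllable a b U) :
    ∃ k, ∀ N ≥ k, ∃ u : ℕ → W, (∀ i, u i ∈ U) ∧ (a ^ N) x + steer a b N u = 0 := by
  obtain ⟨k, u, hu, h⟩ := hx
  refine ⟨k, fun N hN => ?_⟩
  obtain ⟨j, rfl⟩ := Nat.exists_eq_add_of_le hN
  exact ⟨concat k u 0, concat_mem hu (fun _ => h0), by rw [state_concat, h]; simp⟩

theorem convex_reachableFromZero (hU : Convex ℝ U) (h0 : (0 : W) ∈ U) :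
    Convex ℝ (reachableFromZero a b U) := by
  intro x hx y hy s t hs ht hst
  obtain ⟨k, hk⟩ := reachableFromZero_at_time_ge h0 hx
  obtain ⟨j, hj⟩ := reachableFromZero_at_time_ge h0 hy
  obtain ⟨u, hu, rfl⟩ := hk _ (le_max_left k j)
  obtain ⟨v, hv, rfl⟩ := hj _ (le_max_right k j)
  exact ⟨max k j, s • u + t • v, fun i => hU (hu i) (hv i) hs ht hst, by simp⟩

theorem convex_nullControllable (hU : Convex ℝ U) (h0 : (0 : W) ∈ U) :
    Convex ℝ (nullControllable a b U) := by
  intro x hx y hy s t hs ht hst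
  obtain ⟨k, hk⟩ := nullControllable_at_time_ge h0 hx
  obtain ⟨j, hj⟩ := nullControllable_at_time_ge h0 hy
  obtain ⟨u, hu, hux⟩ := hk _ (le_max_left k j)
  obtain ⟨v, hv, hvy⟩ := hj _ (le_max_right k j)
  refine ⟨max k j, s • u + t • v, fun i => hU (hu i) (hv i) hs ht hst, ?_⟩
  have : s • ((a ^ max k j) x + steer a b (max k j) u)
      + t • ((a ^ max k j) y + steer a b (max k j) v) = 0 := by
    rw [hux, hvy]
    simp
  rw [← this]
  simp only [map_add, map_smul]
  module

theorem mem_nullControllable_of_state_mem {x : V} {k : ℕ} {u : ℕ → W} (hu : ∀ i, u i ∈ U)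
    (h : (a ^ k) x + steer a b k u ∈ nullControllable a b U) : x ∈ nullControllable a b U := by
  obtain ⟨j, v, hv, hjv⟩ := h
  exact ⟨k + j, concat k u v, concat_mem hu hv, by rw [state_concat, hjv]⟩

theorem state_mem_reachableFromZero {x : V} {k : ℕ} {u : ℕ → W} (hu : ∀ i, u i ∈ U)
    (h : x ∈ reachableFromZero a b U) :
    (a ^ k) x + steer a b k u ∈ reachableFromZero a b U := by
  obtain ⟨j, v, hv, rfl⟩ := h
  exact ⟨j + k, concat j v u, concat_mem hv hu, by rw [steer_concat]⟩

variable {Eu Es : Submodule ℝ V}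

/-- With the zero control a stable vector converges to `0`, and so enters a neighbourhood of `0` of
null-controllable points. -/
theorem stable_le_nullControllable [FiniteDimensional ℝ V] (hs : IsHyperbolicSplitting a Eu Es)
    (hc : ∀ y, ∃ k u, steer a b k u = y) (hU : U ∈ 𝓝 0) {x : V} (hx : x ∈ Es) :
    x ∈ nullControllable a b U := by
  obtain ⟨δ, hδ, hball⟩ := Metric.mem_nhds_iff.1 (nullControllable_mem_nhds hc hU)
  have hpos : 0 < ‖x‖ + 1 := by positivity
  obtain ⟨n, hn⟩ := (hs.contracts (δ / (‖x‖ + 1)) (by positivity)).exists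
  refine mem_nullControllable_of_state_mem (k := n) (u := 0)
    (fun _ => mem_of_mem_nhds hU) (hball ?_)
  rw [map_zero, add_zero, mem_ball_zero_iff]
  refine (hn x hx).trans_lt ?_
  rw [div_mul_eq_mul_div, div_lt_iff₀ hpos]
  nlinarith

theorem restrict_unstable_injective (hs : IsHyperbolicSplitting a Eu Es) :
    Function.Injective (a.restrict hs.mapsTo_unstable) := by
  rw [← LinearMap.ker_eq_bot, LinearMap.ker_eq_bot']
  intro x hx
  obtain ⟨k, hk, hk1⟩ := ((hs.expands 1 one_pos).and (eventually_ge_atTop 1)).exists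
  obtain ⟨j, rfl⟩ := Nat.exists_eq_add_of_le' hk1
  have hx' : a (x : V) = 0 := by
    have := congrArg Subtype.val hx
    simpa [LinearMap.restrict_apply] using this
  have := hk x x.2
  rw [pow_succ, Module.End.mul_apply, hx', map_zero, norm_zero, mul_zero] at this
  exact Subtype.ext (norm_le_zero_iff.1 this)

theorem det_restrict_unstable_ne_zero [FiniteDimensional ℝ V]
    (hs : IsHyperbolicSplitting a Eu Es) : LinearMap.det (a.restrict hs.mapsTo_unstable) ≠ 0 := by
  exact (LinearEquiv.isUnit_det'
    (LinearEquiv.ofInjectiveEndo _ (restrict_unstable_injective hs))).ne_zero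

theorem surjOn_pow_unstable [FiniteDimensional ℝ V] (hs : IsHyperbolicSplitting a Eu Es) (n : ℕ)
    {z : V} (hz : z ∈ Eu) : ∃ y ∈ Eu, (a ^ n) y = z := by
  have hsurj := LinearMap.surjective_of_injective (restrict_unstable_injective hs)
  induction n generalizing z with
  | zero => exact ⟨z, hz, by simp⟩
  | succ n ih =>
    obtain ⟨y, hy⟩ := hsurj ⟨z, hz⟩
    obtain ⟨x, hx, hxy⟩ := ih y.2
    refine ⟨x, hx, ?_⟩
    rw [pow_succ_apply', hxy]
    exact congrArg Subtype.val hy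

/-- The reachable set of `0` is invariant under translations by unstable vectors: `z ∈ Eu` is `aⁿ x`
with `x` small, hence reachable, and the zero control then carries `x` to `z`, while in the last
part of this time span the control for `y` is superposed. -/
theorem add_unstable_mem_reachableFromZero [FiniteDimensional ℝ V]
    (hs : IsHyperbolicSplitting a Eu Es) (hc : ∀ y, ∃ k u, steer a b k u = y) (hU : U ∈ 𝓝 0)
    {y z : V} (hy : y ∈ reachableFromZero a b U) (hz : z ∈ Eu) :
    y + z ∈ reachableFromZero a b U := by
  have h0 : (0 : W) ∈ U := mem_of_mem_nhds hU
  obtain ⟨δ, hδ, hball⟩ := Metric.mem_nhds_iff.1 (reachableFromZero_mem_nhds hc hU)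
  obtain ⟨k, hk⟩ := reachableFromZero_at_time_ge h0 hy
  have hpos : 0 < ‖z‖ + 1 := by positivity
  obtain ⟨n, hn, hkn⟩ := ((hs.expands (δ / (‖z‖ + 1)) (by positivity)).and
    (eventually_ge_atTop k)).exists
  obtain ⟨x, hx, rfl⟩ := surjOn_pow_unstable hs n hz
  obtain ⟨v, hv, rfl⟩ := hk n hkn
  obtain ⟨N, w, hw, rfl⟩ : x ∈ reachableFromZero a b U := by
    refine hball (mem_ball_zero_iff.2 ((hn x hx).trans_lt ?_))
    rw [div_mul_eq_mul_div, div_lt_iff₀ hpos]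
    nlinarith
  exact ⟨N + n, concat N w v, concat_mem hw hv, by rw [steer_concat, add_comm]⟩

/-- A point to which some solutions starting there return approximately, at arbitrarily late times,
lies in the closures of both the reachable set of `0` and the null-controllable set. If
`aᵏ x + r ≈ x` with `k` large, then the stable part of `x` is close to that of the reachable point
`r`, and the unstable part of `x` is close to that of a point steered by the same control into
`Es`. By invariance under `Eu` and `Es`, respectively, the other component does not matter. -/
theorem mem_closure_of_recurrent [FiniteDimensional ℝ V] (hs : IsHyperbolicSplitting a Eu Es)
    (hc : ∀ y, ∃ k u, steer a b k u = y) (hU : U ∈ 𝓝 0) {x : V}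
    (h : ∀ n : ℕ, ∀ ε > 0, ∃ k ≥ n, ∃ u : ℕ → W, (∀ i, u i ∈ U) ∧
      ‖(a ^ k) x + steer a b k u - x‖ < ε) :
    x ∈ closure (reachableFromZero a b U) ∧ x ∈ closure (nullControllable a b U) := by
  set Pu := Eu.projection Es hs.isCompl with hPu
  set Ps := Es.projection Eu hs.isCompl.symm with hPs
  have hmemu : ∀ y, Pu y ∈ Eu := Submodule.projection_apply_mem _
  have hmems : ∀ y, Ps y ∈ Es := Submodule.projection_apply_mem _
  have hadd : ∀ y, Pu y + Ps y = y := fun y =>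
    Submodule.projection_add_projection_eq_self hs.isCompl y
  obtain ⟨Mu, hMu0, hMu⟩ := exists_bound_linearMap Pu
  obtain ⟨Ms, hMs0, hMs⟩ := exists_bound_linearMap Ps
  -- At a late return time with a small error, the identity `aᵏ x + r = x + e` holds up to small
  -- errors for the stable and unstable parts separately.
  have key : ∀ r > 0, ∃ k u, (∀ i, u i ∈ U) ∧
      ‖(a ^ k) (Ps x) + Ps (steer a b k u) - Ps x‖ ≤ r ∧ ‖(a ^ k) (Ps x)‖ ≤ r ∧
      ‖(a ^ k) (Pu x) + Pu (steer a b k u) - Pu x‖ ≤ r ∧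
      (∀ y ∈ Eu, ‖y‖ ≤ r * ‖(a ^ k) y‖) := by
    intro r hr
    obtain ⟨n, hn⟩ := eventually_atTop.1
      ((hs.contracts (r / (‖Ps x‖ + 1)) (by positivity)).and (hs.expands r hr))
    obtain ⟨k, hk, u, hu, hku⟩ := h n (r / (Mu + Ms + 1)) (by positivity)
    have hstate : (a ^ k) x + steer a b k u - x =
        ((a ^ k) (Pu x) + Pu (steer a b k u) - Pu x) +
        ((a ^ k) (Ps x) + Ps (steer a b k u) - Ps x) := by
      have h1 := hadd x
      have h2 := hadd (steer a b k u)
      have h3 : (a ^ k) x = (a ^ k) (Pu x) + (a ^ k) (Ps x) := by rw [← map_add, h1]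
      rw [h3]
      nth_rewrite 1 [← h2]
      nth_rewrite 3 [← h1]
      abel
    have hu_mem : (a ^ k) (Pu x) + Pu (steer a b k u) - Pu x ∈ Eu :=
      sub_mem (add_mem (pow_mem_of_mapsTo hs.mapsTo_unstable k (hmemu x)) (hmemu _)) (hmemu x)
    have hs_mem : (a ^ k) (Ps x) + Ps (steer a b k u) - Ps x ∈ Es :=
      sub_mem (add_mem (pow_mem_of_mapsTo hs.mapsTo_stable k (hmems x)) (hmems _)) (hmems x)
    have hproju : Pu ((a ^ k) x + steer a b k u - x) =
        (a ^ k) (Pu x) + Pu (steer a b k u) - Pu x := by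
      rw [hstate, map_add, Submodule.projection_apply_of_mem_left _ hu_mem,
        Submodule.projection_apply_of_mem_right _ hs_mem, add_zero]
    have hprojs : Ps ((a ^ k) x + steer a b k u - x) =
        (a ^ k) (Ps x) + Ps (steer a b k u) - Ps x := by
      rw [hstate, map_add, Submodule.projection_apply_of_mem_left _ hs_mem,
        Submodule.projection_apply_of_mem_right _ hu_mem, zero_add]
    have hM : 0 < Mu + Ms + 1 := by positivity
    have hsmall : (Mu + Ms + 1) * ‖(a ^ k) x + steer a b k u - x‖ ≤ r := by
      have := (lt_div_iff₀ hM).1 hku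
      linarith
    have hnn := norm_nonneg ((a ^ k) x + steer a b k u - x)
    refine ⟨k, u, hu, ?_, ?_, ?_, (hn k hk).2⟩
    · rw [← hprojs]
      refine (hMs _).trans (le_trans ?_ hsmall)
      exact mul_le_mul_of_nonneg_right (by linarith) hnn
    · refine ((hn k hk).1 _ (hmems x)).trans ?_
      have : 0 < ‖Ps x‖ + 1 := by positivity
      rw [div_mul_eq_mul_div, div_le_iff₀ this]
      nlinarith
    · rw [← hproju]
      refine (hMu _).trans (le_trans ?_ hsmall)
      exact mul_le_mul_of_nonneg_right (by linarith) hnn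
  constructor
  · rw [Metric.mem_closure_iff]
    intro ε hε
    obtain ⟨k, u, hu, h1, h2, -, -⟩ := key (ε / 4) (by positivity)
    refine ⟨_, add_unstable_mem_reachableFromZero hs hc hU ⟨k, u, hu, rfl⟩
      (sub_mem (hmemu x) (hmemu (steer a b k u))), ?_⟩
    have : x - (steer a b k u + (Pu x - Pu (steer a b k u))) =
        (a ^ k) (Ps x) - ((a ^ k) (Ps x) + Ps (steer a b k u) - Ps x) := by
      nth_rewrite 1 [← hadd x]
      nth_rewrite 1 [← hadd (steer a b k u)]
      abel
    rw [dist_eq_norm, this]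
    refine (norm_sub_le _ _).trans_lt ?_
    linarith
  · rw [Metric.mem_closure_iff]
    intro ε hε
    obtain ⟨k, u, hu, -, -, h3, h4⟩ := key (min 1 (ε / (‖Pu x‖ + 2))) (by positivity)
    obtain ⟨c, hc', hcz⟩ := surjOn_pow_unstable hs k (neg_mem (hmemu (steer a b k u)))
    refine ⟨c + Ps x, ?_, ?_⟩
    · refine mem_nullControllable_of_state_mem (k := k) hu
        (stable_le_nullControllable hs hc hU ?_)
      have : (a ^ k) (c + Ps x) + steer a b k u = (a ^ k) (Ps x) + Ps (steer a b k u) := by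
        rw [map_add, hcz]
        nth_rewrite 2 [← hadd (steer a b k u)]
        abel
      rw [this]
      exact add_mem (pow_mem_of_mapsTo hs.mapsTo_stable k (hmems x)) (hmems _)
    · have hx : x - (c + Ps x) = Pu x - c := by
        nth_rewrite 1 [← hadd x]
        abel
      rw [dist_eq_norm, hx]
      have h5 := h4 _ (sub_mem (hmemu x) hc')
      have h6 : (a ^ k) (Pu x - c) =
          Pu x + ((a ^ k) (Pu x) + Pu (steer a b k u) - Pu x) := by
        rw [map_sub, hcz]
        abel
      rw [h6] at h5
      have h7 := norm_add_le (Pu x) ((a ^ k) (Pu x) + Pu (steer a b k u) - Pu x)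
      have h8 : min 1 (ε / (‖Pu x‖ + 2)) ≤ 1 := min_le_left _ _
      have h9 : min 1 (ε / (‖Pu x‖ + 2)) ≤ ε / (‖Pu x‖ + 2) := min_le_right _ _
      have hpos : 0 < ‖Pu x‖ + 2 := by positivity
      calc ‖Pu x - c‖ ≤ _ := h5
        _ ≤ ε / (‖Pu x‖ + 2) * (‖Pu x‖ + 1) :=
            mul_le_mul h9 (by linarith) (norm_nonneg _) (by positivity)
        _ < ε := by
            rw [div_mul_eq_mul_div, div_lt_iff₀ hpos]
            nlinarith

theorem exists_bound_steer [FiniteDimensional ℝ V] [FiniteDimensional ℝ W]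
    (hU : Bornology.IsBounded U) (k : ℕ) :
    ∃ M, 0 ≤ M ∧ ∀ u : ℕ → W, (∀ i, u i ∈ U) → ‖steer a b k u‖ ≤ M := by
  obtain ⟨R, hR⟩ := hU.exists_norm_le
  obtain ⟨Ma, hMa0, hMa⟩ := exists_bound_linearMap a
  obtain ⟨Mb, hMb0, hMb⟩ := exists_bound_linearMap b
  induction k with
  | zero => exact ⟨0, le_rfl, fun u _ => by simp⟩
  | succ k ih =>
    obtain ⟨M, hM0, hM⟩ := ih
    refine ⟨Ma * M + Mb * |R|, by positivity, fun u hu => ?_⟩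
    rw [steer_succ]
    refine (norm_add_le _ _).trans (add_le_add ?_ ?_)
    · exact (hMa _).trans (mul_le_mul_of_nonneg_left (hM u hu) hMa0)
    · exact (hMb _).trans (mul_le_mul_of_nonneg_left ((hR _ (hu k)).trans (le_abs_self R)) hMb0)

theorem projection_pow_comm {E F : Submodule ℝ V} (hEF : IsCompl E F)
    (hE : ∀ x ∈ E, a x ∈ E) (hF : ∀ x ∈ F, a x ∈ F) (k : ℕ) (x : V) :
    E.projection F hEF ((a ^ k) x) = (a ^ k) (E.projection F hEF x) := by
  conv_lhs => rw [← Submodule.projection_add_projection_eq_self hEF x, map_add, map_add]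
  rw [Submodule.projection_apply_of_mem_left _
      (pow_mem_of_mapsTo hE k (Submodule.projection_apply_mem hEF x)),
    Submodule.projection_apply_of_mem_right _
      (pow_mem_of_mapsTo hF k (Submodule.projection_apply_mem hEF.symm x)), add_zero]

/-- With `‖aᵀ x‖ ≤ ‖x‖ / 2` on `Es`, the stable part of a reachable point satisfies a contracting
recursion over time blocks of length `T`. -/
theorem exists_bound_stable_reachableFromZero [FiniteDimensional ℝ V] [FiniteDimensional ℝ W]
    (hs : IsHyperbolicSplitting a Eu Es) (hb : Bornology.IsBounded U) (h0 : (0 : W) ∈ U) :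
    ∃ M, ∀ x ∈ reachableFromZero a b U, ‖Es.projection Eu hs.isCompl.symm x‖ ≤ M := by
  obtain ⟨T, hT, hT1⟩ := ((hs.contracts 2⁻¹ (by norm_num)).and (eventually_ge_atTop 1)).exists
  obtain ⟨M, hM0, hM⟩ := exists_bound_steer (a := a) (b := b) hb T
  set Ps := Es.projection Eu hs.isCompl.symm with hPs
  obtain ⟨Ms, hMs0, hMs⟩ := exists_bound_linearMap Ps
  have key : ∀ n (u : ℕ → W), (∀ i, u i ∈ U) →
      ‖Ps (steer a b (n * T) u)‖ ≤ 2 * (Ms * M) := by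
    intro n
    induction n with
    | zero => intro u _; simp; positivity
    | succ n ih =>
      intro u hu
      have h1 := state_split (a := a) (b := b) (n * T) T 0 u
      simp only [map_zero, zero_add] at h1
      rw [Nat.succ_mul, h1, map_add, hPs,
        projection_pow_comm _ hs.mapsTo_stable hs.mapsTo_unstable, ← hPs]
      have h2 := hT _ (Submodule.projection_apply_mem hs.isCompl.symm (steer a b (n * T) u))
      have h3 := ih u hu
      have h4 := hM _ fun i => hu (n * T + i)
      have h5 := hMs (steer a b T fun i => u (n * T + i))
      have h6 := mul_le_mul_of_nonneg_left h4 hMs0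
      refine (norm_add_le _ _).trans ?_
      linarith
  refine ⟨2 * (Ms * M), fun x hx => ?_⟩
  obtain ⟨k, hk⟩ := reachableFromZero_at_time_ge h0 hx
  obtain ⟨u, hu, rfl⟩ := hk (k * T) (Nat.le_mul_of_pos_right k hT1)
  exact key k u hu

/-- With `‖x‖ ≤ ‖aᵀ x‖ / 2` on `Eu`, the unstable part of a null-controllable point satisfies a
contracting recursion, backwards over time blocks of length `T`. -/
theorem exists_bound_unstable_nullControllable [FiniteDimensional ℝ V] [FiniteDimensional ℝ W]
    (hs : IsHyperbolicSplitting a Eu Es) (hb : Bornology.IsBounded U) (h0 : (0 : W) ∈ U) :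
    ∃ M, ∀ x ∈ nullControllable a b U, ‖Eu.projection Es hs.isCompl x‖ ≤ M := by
  obtain ⟨T, hT, hT1⟩ := ((hs.expands 2⁻¹ (by norm_num)).and (eventually_ge_atTop 1)).exists
  obtain ⟨M, hM0, hM⟩ := exists_bound_steer (a := a) (b := b) hb T
  set Pu := Eu.projection Es hs.isCompl with hPu
  obtain ⟨Mu, hMu0, hMu⟩ := exists_bound_linearMap Pu
  have key : ∀ n (x : V) (u : ℕ → W), (∀ i, u i ∈ U) → (a ^ (n * T)) x + steer a b (n * T) u = 0 →
      ‖Pu x‖ ≤ Mu * M := by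
    intro n
    induction n with
    | zero =>
      intro x u _ h
      obtain rfl : x = 0 := by simpa using h
      simp
      positivity
    | succ n ih =>
      intro x u hu h
      rw [Nat.succ_mul, add_comm (n * T) T, state_split] at h
      have h1 := ih _ _ (fun i => hu (T + i)) h
      rw [map_add, hPu, projection_pow_comm _ hs.mapsTo_unstable hs.mapsTo_stable, ← hPu] at h1
      have h2 := hT _ (Submodule.projection_apply_mem hs.isCompl x)
      have h3 := norm_sub_le ((a ^ T) (Pu x) + Pu (steer a b T u)) (Pu (steer a b T u))
      rw [add_sub_cancel_right] at h3
      have h4 := (hMu (steer a b T u)).trans (mul_le_mul_of_nonneg_left (hM u hu) hMu0)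
      linarith
  refine ⟨Mu * M, fun x hx => ?_⟩
  obtain ⟨k, hk⟩ := nullControllable_at_time_ge h0 hx
  obtain ⟨u, hu, h⟩ := hk (k * T) (Nat.le_mul_of_pos_right k hT1)
  exact key k x u hu h

end Steering

/-! ### The control set with nonvoid interior -/

section ControlSets

variable {V W : Type*} [NormedAddCommGroup V] [NormedSpace ℝ V]
  [NormedAddCommGroup W] [NormedSpace ℝ W]
  {a : V →ₗ[ℝ] V} {b : W →ₗ[ℝ] V} {U : Set W} {F : V → U → V} {Eu Es : Submodule ℝ V}

theorem trajectory_eq (hF : ∀ x u, F x u = a x + b u) (x : V) (u : ℕ → U) (k : ℕ) :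
    trajectory F x u k = (a ^ k) x + steer a b k (fun i => (u i : W)) := by
  induction k with
  | zero => simp [trajectory]
  | succ k ih =>
    rw [trajectory, hF, ih, steer_succ, pow_succ_apply', map_add, add_assoc]

theorem mem_reachableSet_iff (hF : ∀ x u, F x u = a x + b u) {x y : V} :
    y ∈ reachableSet F x ↔
      ∃ k, 1 ≤ k ∧ ∃ u : ℕ → W, (∀ i, u i ∈ U) ∧ (a ^ k) x + steer a b k u = y := by
  constructor
  · rintro ⟨k, hk, u, rfl⟩
    exact ⟨k, hk, _, fun i => (u i).2, (trajectory_eq hF x u k).symm⟩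
  · rintro ⟨k, hk, u, hu, rfl⟩
    exact ⟨k, hk, fun i => ⟨u i, hu i⟩, trajectory_eq hF x _ k⟩

theorem exists_trajectory_mem_iff (hF : ∀ x u, F x u = a x + b u) {x : V} {D : Set V} :
    (∃ u : ℕ → U, ∀ k : ℕ, 1 ≤ k → trajectory F x u k ∈ D) ↔
      ∃ u : ℕ → W, (∀ i, u i ∈ U) ∧ ∀ k, 1 ≤ k → (a ^ k) x + steer a b k u ∈ D := by
  constructor
  · rintro ⟨u, h⟩
    exact ⟨_, fun i => (u i).2, fun k hk => trajectory_eq hF x u k ▸ h k hk⟩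
  · rintro ⟨u, hu, h⟩
    exact ⟨fun i => ⟨u i, hu i⟩, fun k hk => (trajectory_eq hF x _ k).symm ▸ h k hk⟩

/-- The control set with nonvoid interior: the null-controllable points in the closure of the
reachable set of `0`. -/
def mainControlSet (a : V →ₗ[ℝ] V) (b : W →ₗ[ℝ] V) (U : Set W) : Set V :=
  closure (reachableFromZero a b U) ∩ nullControllable a b U

theorem state_mem_closure_reachableFromZero [FiniteDimensional ℝ V] {x : V} {k : ℕ} {u : ℕ → W}
    (hu : ∀ i, u i ∈ U) (hx : x ∈ closure (reachableFromZero a b U)) :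
    (a ^ k) x + steer a b k u ∈ closure (reachableFromZero a b U) := by
  have hcont : Continuous fun y : V => (a ^ k) y + steer a b k u :=
    (LinearMap.continuous_of_finiteDimensional (a ^ k)).add continuous_const
  exact map_mem_closure (f := fun y : V => (a ^ k) y + steer a b k u) hcont hx
    fun y hy => state_mem_reachableFromZero hu hy

/-- No return: a solution which starts and ends in the control set stays in it in between. -/
theorem state_mem_mainControlSet_of_le [FiniteDimensional ℝ V] {x : V} {k j : ℕ} {u : ℕ → W}
    (hu : ∀ i, u i ∈ U) (hx : x ∈ mainControlSet a b U) (hjk : j ≤ k)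
    (h : (a ^ k) x + steer a b k u ∈ mainControlSet a b U) :
    (a ^ j) x + steer a b j u ∈ mainControlSet a b U := by
  refine ⟨state_mem_closure_reachableFromZero hu hx.1, ?_⟩
  obtain ⟨i, rfl⟩ := Nat.exists_eq_add_of_le hjk
  rw [state_split] at h
  exact mem_nullControllable_of_state_mem (fun i => hu (j + i)) h.2

theorem mainControlSet_mem_nhds_zero [FiniteDimensional ℝ V]
    (hc : ∀ y, ∃ k u, steer a b k u = y) (hU : U ∈ 𝓝 0) : mainControlSet a b U ∈ 𝓝 0 :=
  inter_mem (mem_of_superset (reachableFromZero_mem_nhds hc hU) subset_closure)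
    (nullControllable_mem_nhds hc hU)

theorem zero_mem_reachableSet (hF : ∀ x u, F x u = a x + b u) (h0 : (0 : W) ∈ U) {x : V}
    (hx : x ∈ nullControllable a b U) : 0 ∈ reachableSet F x := by
  obtain ⟨k, hk⟩ := nullControllable_at_time_ge h0 hx
  obtain ⟨u, hu, h⟩ := hk (k + 1) (by omega)
  exact (mem_reachableSet_iff hF).2 ⟨k + 1, by omega, u, hu, h⟩

theorem reachableSet_trans (hF : ∀ x u, F x u = a x + b u) {x y z : V}
    (hxy : y ∈ reachableSet F x) (hyz : z ∈ reachableSet F y) : z ∈ reachableSet F x := by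
  rw [mem_reachableSet_iff hF] at *
  obtain ⟨k, hk, u, hu, rfl⟩ := hxy
  obtain ⟨j, hj, v, hv, rfl⟩ := hyz
  exact ⟨k + j, by omega, _, concat_mem hu hv, state_concat k j x u v⟩

theorem reachableSet_zero (hF : ∀ x u, F x u = a x + b u) (h0 : (0 : W) ∈ U) :
    reachableSet F 0 = reachableFromZero a b U := by
  ext y
  rw [mem_reachableSet_iff hF]
  constructor
  · rintro ⟨k, -, u, hu, rfl⟩
    exact ⟨k, u, hu, by simp⟩
  · intro hy
    obtain ⟨k, hk⟩ := reachableFromZero_at_time_ge h0 hy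
    obtain ⟨u, hu, h⟩ := hk (k + 1) (by omega)
    exact ⟨k + 1, by omega, u, hu, by simpa using h⟩

theorem mainControlSet_subset_closure_reachableSet (hF : ∀ x u, F x u = a x + b u)
    (h0 : (0 : W) ∈ U) {x : V} (hx : x ∈ nullControllable a b U) :
    mainControlSet a b U ⊆ closure (reachableSet F x) := by
  refine Set.inter_subset_left.trans (closure_mono ?_)
  rw [← reachableSet_zero hF h0]
  exact fun y hy => reachableSet_trans hF (zero_mem_reachableSet hF h0 hx) hy

theorem exists_control_in_mainControlSet [FiniteDimensional ℝ V] (h0 : (0 : W) ∈ U) {x : V}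
    (hx : x ∈ mainControlSet a b U) :
    ∃ u : ℕ → W, (∀ i, u i ∈ U) ∧ ∀ k, (a ^ k) x + steer a b k u ∈ mainControlSet a b U := by
  have hzero : (0 : V) ∈ mainControlSet a b U :=
    ⟨subset_closure (zero_mem_reachableFromZero h0), zero_mem_nullControllable h0⟩
  obtain ⟨k, u, hu, h⟩ := hx.2
  have hu' : ∀ i, concat k u 0 i ∈ U := concat_mem hu fun _ => h0
  refine ⟨concat k u 0, hu', fun j => ?_⟩
  refine state_mem_mainControlSet_of_le (k := k + j) hu' hx (by omega) ?_
  rw [state_concat, h]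
  simpa using hzero

theorem isControlSet_mainControlSet [FiniteDimensional ℝ V] (hF : ∀ x u, F x u = a x + b u)
    (hc : ∀ y, ∃ k u, steer a b k u = y) (hU : U ∈ 𝓝 0) :
    IsControlSet F (mainControlSet a b U) := by
  have h0 : (0 : W) ∈ U := mem_of_mem_nhds hU
  have hzero : (0 : V) ∈ mainControlSet a b U :=
    mem_of_mem_nhds (mainControlSet_mem_nhds_zero hc hU)
  refine ⟨⟨⟨0, hzero⟩, fun x hx => mainControlSet_subset_closure_reachableSet hF h0 hx.2,
    fun x hx => ?_⟩, ?_⟩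
  · rw [exists_trajectory_mem_iff hF]
    obtain ⟨u, hu, h⟩ := exists_control_in_mainControlSet h0 hx
    exact ⟨u, hu, fun k _ => h k⟩
  · rintro E ⟨-, hE, -⟩ hDE x hx
    refine ⟨reachableSet_zero hF h0 ▸ hE 0 (hDE hzero) hx, ?_⟩
    obtain ⟨y, hy, hyx⟩ := mem_closure_iff_nhds.1 (hE x hx (hDE hzero)) _
      (nullControllable_mem_nhds hc hU)
    obtain ⟨k, -, u, hu, rfl⟩ := (mem_reachableSet_iff hF).1 hyx
    exact mem_nullControllable_of_state_mem hu hy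

/-- A solution may first remain in the control set for a prescribed time; from there it can still
return close to its starting point. -/
theorem IsControlSet.recurrent (hF : ∀ x u, F x u = a x + b u) {D : Set V}
    (hD : IsControlSet F D) {x : V} (hx : x ∈ D) (n : ℕ) {ε : ℝ} (hε : 0 < ε) :
    ∃ k ≥ n, ∃ u : ℕ → W, (∀ i, u i ∈ U) ∧ ‖(a ^ k) x + steer a b k u - x‖ < ε := by
  obtain ⟨-, hcl, hstay⟩ := hD.prop
  obtain ⟨u, hu, hstay⟩ := (exists_trajectory_mem_iff hF).1 (hstay x hx)
  obtain ⟨y, hy, hyx⟩ := Metric.mem_closure_iff.1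
    (hcl _ (hstay (n + 1) (by omega)) hx) ε hε
  obtain ⟨k, -, v, hv, rfl⟩ := (mem_reachableSet_iff hF).1 hy
  refine ⟨n + 1 + k, by omega, concat (n + 1) u v, concat_mem hu hv, ?_⟩
  rw [state_concat, ← dist_eq_norm, dist_comm]
  exact hyx

/-- All points of a control set `D` are recurrent, so `D` lies in the closure of the convex set of
null-controllable points. An interior point of the closure of a convex set with nonvoid interior
belongs to the set itself; hence `interior D` consists of null-controllable points. As every point
of `D` reaches `interior D`, all of `D` is null-controllable. -/
theorem IsControlSet.eq_mainControlSet [FiniteDimensional ℝ V]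
    (hs : IsHyperbolicSplitting a Eu Es) (hF : ∀ x u, F x u = a x + b u)
    (hc : ∀ y, ∃ k u, steer a b k u = y) (hconv : Convex ℝ U) (hU : U ∈ 𝓝 0) {D : Set V}
    (hD : IsControlSet F D) (hint : (interior D).Nonempty) : D = mainControlSet a b U := by
  have h0 : (0 : W) ∈ U := mem_of_mem_nhds hU
  have hrec : ∀ x ∈ D, x ∈ closure (reachableFromZero a b U) ∧
      x ∈ closure (nullControllable a b U) := fun x hx =>
    mem_closure_of_recurrent hs hc hU fun n ε hε => hD.recurrent hF hx n hε
  have hintN : interior D ⊆ nullControllable a b U := by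
    have hconvN := convex_nullControllable (a := a) (b := b) hconv h0
    have := hconvN.interior_closure_eq_interior_of_nonempty_interior
      ⟨0, mem_interior_iff_mem_nhds.2 (nullControllable_mem_nhds hc hU)⟩
    exact (interior_mono fun x hx => (hrec x hx).2).trans (this ▸ interior_subset)
  have hsub : D ⊆ mainControlSet a b U := by
    intro x hx
    refine ⟨(hrec x hx).1, ?_⟩
    obtain ⟨y, hy⟩ := hint
    obtain ⟨z, hz, hzx⟩ := mem_closure_iff_nhds.1 (hD.prop.2.1 x hx (interior_subset hy)) _
      (isOpen_interior.mem_nhds hy)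
    obtain ⟨k, -, u, hu, rfl⟩ := (mem_reachableSet_iff hF).1 hzx
    exact mem_nullControllable_of_state_mem hu (hintN hz)
  exact hsub.antisymm (hD.le_of_ge (isControlSet_mainControlSet hF hc hU).prop hsub)

theorem isBounded_mainControlSet [FiniteDimensional ℝ V] [FiniteDimensional ℝ W]
    (hs : IsHyperbolicSplitting a Eu Es) (hb : Bornology.IsBounded U) (h0 : (0 : W) ∈ U) :
    Bornology.IsBounded (mainControlSet a b U) := by
  obtain ⟨Ms, hMs⟩ := exists_bound_stable_reachableFromZero (b := b) hs hb h0
  obtain ⟨Mu, hMu⟩ := exists_bound_unstable_nullControllable (b := b) hs hb h0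
  refine isBounded_iff_forall_norm_le.2 ⟨Mu + Ms, fun x hx => ?_⟩
  have hclosed : IsClosed {x : V | ‖Es.projection Eu hs.isCompl.symm x‖ ≤ Ms} :=
    isClosed_le (LinearMap.continuous_of_finiteDimensional _).norm continuous_const
  have h1 : ‖Es.projection Eu hs.isCompl.symm x‖ ≤ Ms :=
    closure_minimal (s := reachableFromZero a b U) hMs hclosed hx.1
  rw [← Submodule.projection_add_projection_eq_self hs.isCompl x]
  exact (norm_add_le _ _).trans (add_le_add (hMu x hx.2) h1)

theorem state_equilibrium {x : V} {u : W} (hx : a x + b u = x) (k : ℕ) :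
    (a ^ k) x + steer a b k (fun _ => u) = x := by
  induction k with
  | zero => simp
  | succ k ih =>
    rw [pow_succ_apply', steer_succ, ← add_assoc, ← map_add, ih, hx]

/-- The equilibrium of a constant control in `U` is recurrent, hence in the closures of two convex
neighbourhoods of `0`; shrinking it moves it into their interiors. -/
theorem smul_equilibrium_mem_interior [FiniteDimensional ℝ V]
    (hs : IsHyperbolicSplitting a Eu Es) (hc : ∀ y, ∃ k u, steer a b k u = y)
    (hconv : Convex ℝ U) (hU : U ∈ 𝓝 0) {x : V} {u : W} (hu : u ∈ U) (hx : a x + b u = x)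
    {t : ℝ} (ht0 : 0 ≤ t) (ht1 : t < 1) :
    t • x ∈ interior (reachableFromZero a b U) ∧ t • x ∈ interior (nullControllable a b U) := by
  have h0 : (0 : W) ∈ U := mem_of_mem_nhds hU
  have hcl := mem_closure_of_recurrent hs hc hU (x := x) fun n ε hε =>
    ⟨n, le_rfl, fun _ => u, fun _ => hu, by rwa [state_equilibrium hx, sub_self, norm_zero]⟩
  have key : ∀ s : Set V, Convex ℝ s → s ∈ 𝓝 0 → x ∈ closure s → t • x ∈ interior s := by
    intro s hsc hs0 hxs
    have := hsc.combo_interior_closure_mem_interior (mem_interior_iff_mem_nhds.2 hs0) hxs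
      (sub_pos.2 ht1) ht0 (by ring)
    simpa using this
  exact ⟨key _ (convex_reachableFromZero hconv h0) (reachableFromZero_mem_nhds hc hU) hcl.1,
    key _ (convex_nullControllable hconv h0) (nullControllable_mem_nhds hc hU) hcl.2⟩

end ControlSets

/-! ### Coverings of images of balls under expanding maps -/

section Volume

open MeasureTheory Metric

variable {E : Type*} [NormedAddCommGroup E] [NormedSpace ℝ E] [FiniteDimensional ℝ E]

/-- Volume bound for packings: the balls of radius `ρ / 2` about the points of a `ρ`-separated subset
of `g(B_ρ)` are disjoint and, as `g` is expanding, contained in `g(B_{2ρ})`. -/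
theorem card_le_of_separated_in_image {g : E →ₗ[ℝ] E} (hg : ∀ x, ‖x‖ ≤ ‖g x‖) {ρ : ℝ}
    (hρ : 0 < ρ) {C : Finset E} (hC : ∀ c ∈ C, ∃ y, ‖y‖ ≤ ρ ∧ g y = c)
    (hsep : ∀ c ∈ C, ∀ c' ∈ C, c ≠ c' → ρ < dist c c') :
    (C.card : ℝ) ≤ 4 ^ Module.finrank ℝ E * |LinearMap.det g| := by
  borelize E
  let μ : Measure E := Measure.addHaar
  have hinj : Function.Injective g := by
    rw [← LinearMap.ker_eq_bot, LinearMap.ker_eq_bot']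
    intro x hx
    have := hg x
    rw [hx, norm_zero] at this
    exact norm_le_zero_iff.1 this
  have hsurj := LinearMap.surjective_of_injective hinj
  have hdisj : (C : Set E).PairwiseDisjoint fun c => ball c (ρ / 2) := by
    intro c hc c' hc' hne
    exact ball_disjoint_ball (by linarith [hsep c hc c' hc' hne])
  have hsub : (⋃ c ∈ C, ball c (ρ / 2)) ⊆ g '' ball 0 (4 * (ρ / 2)) := by
    intro p hp
    simp only [Set.mem_iUnion] at hp
    obtain ⟨c, hc, hpc⟩ := hp
    obtain ⟨y, hy, rfl⟩ := hC c hc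
    obtain ⟨h, hh⟩ := hsurj (p - g y)
    refine ⟨y + h, ?_, by rw [map_add, hh]; abel⟩
    rw [mem_ball, dist_eq_norm, ← hh] at hpc
    rw [mem_ball_zero_iff]
    have h1 := norm_add_le y h
    have h2 := hg h
    linarith
  have hvol : (C.card : ENNReal) * μ (ball 0 (ρ / 2)) ≤
      ENNReal.ofReal (4 ^ Module.finrank ℝ E * |LinearMap.det g|) * μ (ball 0 (ρ / 2)) := by
    calc (C.card : ENNReal) * μ (ball 0 (ρ / 2)) = ∑ c ∈ C, μ (ball c (ρ / 2)) := by
          simp [Measure.addHaar_ball_center]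
      _ = μ (⋃ c ∈ C, ball c (ρ / 2)) :=
          (measure_biUnion_finset hdisj fun c _ => measurableSet_ball).symm
      _ ≤ μ (g '' ball 0 (4 * (ρ / 2))) := measure_mono hsub
      _ = _ := by
          rw [Measure.addHaar_image_linearMap, Measure.addHaar_ball_mul_of_pos μ 0 (by norm_num),
            ← mul_assoc, ← ENNReal.ofReal_mul (abs_nonneg _), mul_comm (|_|)]
  have hpos : μ (ball 0 (ρ / 2)) ≠ 0 := (measure_ball_pos μ 0 (by positivity)).ne'
  have hfin : μ (ball 0 (ρ / 2)) ≠ ⊤ := measure_ball_lt_top.ne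
  have h := (ENNReal.mul_le_mul_iff_left hpos hfin).1 hvol
  rw [← ENNReal.ofReal_natCast] at h
  exact (ENNReal.ofReal_le_ofReal_iff (by positivity)).1 h

theorem exists_finset_cover_image_ball {g : E →ₗ[ℝ] E} (hg : ∀ x, ‖x‖ ≤ ‖g x‖) {ρ : ℝ}
    (hρ : 0 < ρ) :
    ∃ s : Finset E, (∀ y ∈ s, ‖y‖ ≤ ρ) ∧ (∀ y, ‖y‖ ≤ ρ → ∃ z ∈ s, ‖g (y - z)‖ ≤ ρ) ∧
      (s.card : ℝ) ≤ 4 ^ Module.finrank ℝ E * |LinearMap.det g| := by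
  classical
  lift ρ to NNReal using hρ.le
  set A : Set E := g '' closedBall 0 ρ with hA
  have hcard : ∀ C : Finset E, (C : Set E) ⊆ A → IsSeparated ρ (C : Set E) →
      (C.card : ℝ) ≤ 4 ^ Module.finrank ℝ E * |LinearMap.det g| := by
    intro C hCA hsep
    refine card_le_of_separated_in_image hg hρ (fun c hc => ?_) fun c hc c' hc' hne => ?_
    · obtain ⟨y, hy, rfl⟩ := hCA hc
      exact ⟨y, by simpa using hy, rfl⟩
    · have : (ρ : ENNReal) < edist c c' := hsep hc hc' hne
      rw [edist_dist, ENNReal.lt_ofReal_iff_toReal_lt ENNReal.coe_ne_top] at this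
      simpa using this
  have hpack : packingNumber ρ A ≠ ⊤ := by
    have : packingNumber ρ A ≤ (⌊4 ^ Module.finrank ℝ E * |LinearMap.det g|⌋₊ : ℕ) := by
      refine iSup_le fun C => iSup_le fun hCA => iSup_le fun hsep => ?_
      by_contra! hlt
      obtain ⟨t, htC, ht⟩ := Set.exists_subset_encard_eq (Order.add_one_le_of_lt hlt)
      have htfin : t.Finite := Set.finite_of_encard_eq_coe (k := _ + 1) (by exact_mod_cast ht)
      lift t to Finset E using htfin
      have h1 := Nat.le_floor (hcard t (htC.trans hCA) (hsep.mono htC))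
      rw [Set.encard_coe_eq_coe_finsetCard] at ht
      have h2 : t.card = ⌊4 ^ Module.finrank ℝ E * |LinearMap.det g|⌋₊ + 1 := by
        exact_mod_cast ht
      omega
    exact ne_top_of_le_ne_top (ENat.natCast_ne_top _) this
  have hfin : (maximalSeparatedSet ρ A).Finite := by
    rw [← Set.encard_ne_top_iff, encard_maximalSeparatedSet hpack]
    exact hpack
  have hcover := isCover_maximalSeparatedSet hpack
  obtain ⟨C, hC⟩ := hfin.exists_finset_coe
  have hsubA : (C : Set E) ⊆ A := hC ▸ maximalSeparatedSet_subset
  have hpre : ∀ c ∈ C, ∃ y, y ∈ closedBall (0 : E) ρ ∧ g y = c := fun c hc => hsubA hc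
  choose! y hy hgy using hpre
  refine ⟨C.image y, ?_, fun x hx => ?_, ?_⟩
  · intro z hz
    obtain ⟨c, hc, rfl⟩ := Finset.mem_image.1 hz
    simpa using hy c hc
  · obtain ⟨c, hc, hxc⟩ := hcover (show g x ∈ A from ⟨x, by simpa using hx, rfl⟩)
    rw [← hC] at hc
    refine ⟨y c, Finset.mem_image_of_mem y hc, ?_⟩
    have h1 : edist (g x) c ≤ ρ := hxc
    rw [map_sub, hgy c hc, ← dist_eq_norm]
    rwa [edist_dist, ENNReal.ofReal_le_coe] at h1
  · refine le_trans (Nat.cast_le.2 Finset.card_image_le) (hcard C hsubA ?_)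
    rw [hC]
    exact isSeparated_maximalSeparatedSet

end Volume

/-! ### Lower bounds for spanning sets -/

section LowerBound

open MeasureTheory

variable {V W : Type*} [NormedAddCommGroup V] [NormedSpace ℝ V]
  [NormedAddCommGroup W] [NormedSpace ℝ W]
  {a : V →ₗ[ℝ] V} {b : W →ₗ[ℝ] V} {U : Set W} {F : V → U → V} {Eu Es : Submodule ℝ V}

theorem coe_restrict_pow (hs : IsHyperbolicSplitting a Eu Es) (k : ℕ) (y : Eu) :
    (((a.restrict hs.mapsTo_unstable ^ k) y : Eu) : V) = (a ^ k) (y : V) := by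
  induction k with
  | zero => rfl
  | succ k ih =>
    rw [pow_succ_apply', pow_succ_apply', ← ih]
    rfl

theorem restrict_pow_projectionOnto (hs : IsHyperbolicSplitting a Eu Es) (k : ℕ) (x : V) :
    Eu.projectionOnto Es hs.isCompl ((a ^ k) x) =
      (a.restrict hs.mapsTo_unstable ^ k) (Eu.projectionOnto Es hs.isCompl x) := by
  refine Subtype.ext ?_
  rw [coe_restrict_pow hs, Submodule.coe_projectionOnto_apply, Submodule.coe_projectionOnto_apply,
    projection_pow_comm hs.isCompl hs.mapsTo_unstable hs.mapsTo_stable]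

/-- Volume growth on the unstable subspace: a spanning set of controls for the time `τ` has at least
`v |det a⁺| ^ τ` elements. -/
theorem exists_card_lower_bound [FiniteDimensional ℝ V] (hs : IsHyperbolicSplitting a Eu Es)
    (hF : ∀ x u, F x u = a x + b u) {K Q : Set V} (hKQ : K ⊆ Q) (hQ : Bornology.IsBounded Q)
    (hK : (interior K).Nonempty) :
    ∃ v : ℝ, 0 < v ∧ ∀ τ, 1 ≤ τ → ∀ S : Finset (ℕ → U), IsSpanning F τ K Q (S : Set (ℕ → U)) →
      v * |LinearMap.det (a.restrict hs.mapsTo_unstable)| ^ τ ≤ S.card := by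
  let _ : MeasurableSpace Eu := borel Eu
  have : BorelSpace Eu := ⟨rfl⟩
  let μ : Measure Eu := Measure.addHaar
  set au := a.restrict hs.mapsTo_unstable with hau
  set P := Eu.projectionOnto Es hs.isCompl with hP
  have hPcont : Continuous P := LinearMap.continuous_of_finiteDimensional P
  have hPopen : IsOpenMap P := by
    have := (LinearMap.toContinuousLinearMap P).isOpenMap
      (Submodule.projectionOnto_surjective hs.isCompl)
    simpa using this
  have hQfin : μ (P '' Q) ≠ ⊤ := by
    have : Bornology.IsBounded (P '' Q) := by
      have := (LinearMap.toContinuousLinearMap P).lipschitz.isBounded_image hQ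
      simpa using this
    exact this.measure_lt_top.ne
  have hKpos : 0 < μ (P '' K) := by
    refine lt_of_lt_of_le ?_ (measure_mono (Set.image_mono interior_subset))
    exact (hPopen _ isOpen_interior).measure_pos μ (hK.image P)
  have hKfin : μ (P '' K) ≠ ⊤ := ne_top_of_le_ne_top hQfin (measure_mono (Set.image_mono hKQ))
  have hk : 0 < (μ (P '' K)).toReal := ENNReal.toReal_pos hKpos.ne' hKfin
  have hq : 0 ≤ (μ (P '' Q)).toReal := ENNReal.toReal_nonneg
  refine ⟨(μ (P '' K)).toReal / ((μ (P '' Q)).toReal + 1), by positivity, fun τ hτ S hS => ?_⟩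
  -- The part of `K` which a fixed control keeps in `Q` expands by the factor `|det au| ^ τ` and
  -- still fits, up to a translation, into the projection of `Q`.
  let Ku : (ℕ → U) → Set V := fun u =>
    {x ∈ K | (a ^ τ) x + steer a b τ (fun i => (u i : W)) ∈ Q}
  have hcov : P '' K ⊆ ⋃ u ∈ S, P '' Ku u := by
    rintro _ ⟨x, hx, rfl⟩
    obtain ⟨u, hu, hmem⟩ := hS x hx
    have := hmem τ hτ le_rfl
    rw [trajectory_eq hF] at this
    exact Set.mem_biUnion hu ⟨x, ⟨hx, this⟩, rfl⟩
  have hvol : ∀ u, ENNReal.ofReal (|LinearMap.det au| ^ τ) * μ (P '' Ku u) ≤ μ (P '' Q) := by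
    intro u
    rw [← abs_pow, ← map_pow, ← Measure.addHaar_image_linearMap,
      ← measure_preimage_add_right μ (P (steer a b τ fun i => (u i : W))) (P '' Q)]
    refine measure_mono ?_
    rintro _ ⟨_, ⟨x, hx, rfl⟩, rfl⟩
    exact ⟨_, hx.2, by rw [map_add, hP, restrict_pow_projectionOnto hs, ← hP]⟩
  have hsum : ENNReal.ofReal (|LinearMap.det au| ^ τ) * μ (P '' K) ≤ S.card * μ (P '' Q) := by
    calc ENNReal.ofReal (|LinearMap.det au| ^ τ) * μ (P '' K)
        ≤ ENNReal.ofReal (|LinearMap.det au| ^ τ) * ∑ u ∈ S, μ (P '' Ku u) := by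
          gcongr
          exact (measure_mono hcov).trans (measure_biUnion_finset_le S _)
      _ = ∑ u ∈ S, ENNReal.ofReal (|LinearMap.det au| ^ τ) * μ (P '' Ku u) := Finset.mul_sum _ _ _
      _ ≤ ∑ u ∈ S, μ (P '' Q) := Finset.sum_le_sum fun u _ => hvol u
      _ = S.card * μ (P '' Q) := by rw [Finset.sum_const, nsmul_eq_mul]
  have hreal := ENNReal.toReal_mono (ENNReal.mul_ne_top (ENNReal.natCast_ne_top _) hQfin) hsum
  rw [ENNReal.toReal_mul, ENNReal.toReal_mul, ENNReal.toReal_ofReal (by positivity),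
    ENNReal.toReal_natCast] at hreal
  rw [div_mul_eq_mul_div, div_le_iff₀ (by positivity)]
  have : (0 : ℝ) ≤ S.card := Nat.cast_nonneg _
  nlinarith

/-- A lower bound `N` for the size of finite spanning sets suffices, as the weight of an infinite set
is infinite. -/
theorem spanningWeight_lower_bound {X Ω : Type*} {F : X → Ω → X} {K Q : Set X} {τ : ℕ}
    {f : Ω → ℝ} {c N : ℝ} (hc : ∀ u, c ≤ f u)
    (hN : ∀ S : Finset (ℕ → Ω), IsSpanning F τ K Q (S : Set (ℕ → Ω)) → N ≤ S.card) :
    ENNReal.ofReal (N * Real.exp (τ * c)) ≤ spanningWeight F f τ K Q := by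
  refine le_iInf₂ fun S hS => ?_
  calc ENNReal.ofReal (N * Real.exp (τ * c))
      ≤ S.encard * ENNReal.ofReal (Real.exp (τ * c)) := by
        rw [ENNReal.ofReal_mul' (Real.exp_nonneg _)]
        gcongr
        rcases S.finite_or_infinite with hfin | hinf
        · lift S to Finset (ℕ → Ω) using hfin
          rw [Set.encard_coe_eq_coe_finsetCard, ENat.toENNReal_coe]
          exact ENNReal.ofReal_le_of_le_toReal (by simpa using hN S hS)
        · rw [hinf.encard_eq, ENat.toENNReal_top]
          exact le_top
    _ = ∑' _ : S, ENNReal.ofReal (Real.exp (τ * c)) := (ENNReal.tsum_set_const _ _).symm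
    _ ≤ _ := by
        refine ENNReal.tsum_le_tsum fun u => ENNReal.ofReal_le_ofReal (Real.exp_le_exp.2 ?_)
        calc (τ : ℝ) * c = ∑ _i ∈ Finset.range τ, c := by simp
          _ ≤ _ := Finset.sum_le_sum fun i _ => hc _

end LowerBound

/-! ### Construction of spanning sets -/

section UpperBound

variable {V W : Type*} [NormedAddCommGroup V] [NormedSpace ℝ V]
  [NormedAddCommGroup W] [NormedSpace ℝ W]
  {a : V →ₗ[ℝ] V} {b : W →ₗ[ℝ] V} {U : Set W} {F : V → U → V} {Eu Es : Submodule ℝ V}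

/-- Near an equilibrium `x₀` for the control value `u₀`, about `|det a⁺| ^ T` controls with values
close to `u₀` suffice to bring every point of a neighbourhood `Y` of `x₀` back to `Y` at time `T`.
The neighbourhood does not depend on `T`. The controls are `u₀ + w_z`, where `w_z` steers `z ∈ Eu`
to `0`, for `z` in a finite set such that the points `aᵀ z` form a `ρ`-net in the image of the
`ρ`-ball of `Eu`. -/
theorem exists_block_controls [FiniteDimensional ℝ V] (hs : IsHyperbolicSplitting a Eu Es)
    (hc : ∀ y, ∃ k u, steer a b k u = y) {x₀ : V} {u₀ : W} (hx₀ : a x₀ + b u₀ = x₀)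
    {O : Set W} (hO : O ∈ 𝓝 u₀) {Z : Set V} (hZ : Z ∈ 𝓝 x₀) :
    ∃ Y ∈ 𝓝 x₀, Y ⊆ Z ∧ ∀ᶠ T : ℕ in atTop, ∃ s : Finset (ℕ → W), (∀ u ∈ s, ∀ i, u i ∈ O) ∧
      (s.card : ℝ) ≤ 4 ^ Module.finrank ℝ Eu *
        |LinearMap.det (a.restrict hs.mapsTo_unstable)| ^ T ∧
      ∀ x ∈ Y, ∃ u ∈ s, (a ^ T) x + steer a b T u ∈ Y := by
  classical
  set Pu := Eu.projection Es hs.isCompl with hPu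
  set Ps := Es.projection Eu hs.isCompl.symm with hPs
  have hmemu : ∀ y, Pu y ∈ Eu := Submodule.projection_apply_mem _
  have hmems : ∀ y, Ps y ∈ Es := Submodule.projection_apply_mem _
  obtain ⟨N, κ, hκ, hsteer⟩ := exists_bounded_steering hc
  obtain ⟨M, hM0, hM⟩ := exists_bound_linearMap (a ^ N)
  obtain ⟨δ, hδ, hδO⟩ := Metric.mem_nhds_iff.1 hO
  obtain ⟨η, hη, hηZ⟩ := Metric.mem_nhds_iff.1 hZ
  -- With this radius, the controls which cancel points of the `ρ`-ball have size below `δ`.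
  obtain ⟨ρ, hρ, hρδ, hρη⟩ : ∃ ρ : ℝ, 0 < ρ ∧ κ * (M * ρ) < δ ∧ ρ + ρ < η := by
    have hpos : 0 < κ * M + 1 := by positivity
    refine ⟨min (δ / (κ * M + 1)) (η / 3), by positivity, ?_, ?_⟩
    · have h1 : min (δ / (κ * M + 1)) (η / 3) ≤ δ / (κ * M + 1) := min_le_left _ _
      have h2 : 0 < min (δ / (κ * M + 1)) (η / 3) := by positivity
      rw [le_div_iff₀ hpos] at h1
      nlinarith
    · have : min (δ / (κ * M + 1)) (η / 3) ≤ η / 3 := min_le_right _ _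
      linarith
  refine ⟨{x | ‖Pu (x - x₀)‖ ≤ ρ ∧ ‖Ps (x - x₀)‖ ≤ ρ}, ?_, ?_, ?_⟩
  · have hcont : ∀ P : V →ₗ[ℝ] V, ∀ᶠ x in 𝓝 x₀, ‖P (x - x₀)‖ ≤ ρ := by
      intro P
      have hP : Continuous fun x => ‖P (x - x₀)‖ :=
        ((LinearMap.continuous_of_finiteDimensional P).comp (continuous_sub_right x₀)).norm
      have : Tendsto (fun x => ‖P (x - x₀)‖) (𝓝 x₀) (𝓝 0) := by simpa using hP.tendsto x₀
      exact (this.eventually (gt_mem_nhds hρ)).mono fun x hx => le_of_lt hx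
    exact (hcont Pu).and (hcont Ps)
  · rintro x ⟨h1, h2⟩
    refine hηZ ?_
    rw [Metric.mem_ball, dist_eq_norm,
      ← Submodule.projection_add_projection_eq_self hs.isCompl (x - x₀)]
    exact (norm_add_le _ _).trans_lt (by linarith)
  filter_upwards [hs.contracts 1 one_pos, hs.expands 1 one_pos, eventually_ge_atTop N]
    with T hcontr hexp hNT
  obtain ⟨s, hsρ, hscov, hscard⟩ := exists_finset_cover_image_ball
    (g := a.restrict hs.mapsTo_unstable ^ T)
    (fun x => by simpa [← coe_restrict_pow hs] using hexp x x.2) hρ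
  rw [map_pow, abs_pow] at hscard
  choose w hw hwn hw0 using fun z : Eu => hsteer (-(a ^ N) (z : V))
  have hsteer_w : ∀ z : Eu, steer a b T (w z) = -(a ^ T) (z : V) := by
    intro z
    obtain ⟨j, rfl⟩ := Nat.exists_eq_add_of_le hNT
    have := state_split (a := a) (b := b) N j z (w z)
    rw [hw, add_neg_cancel, map_zero, zero_add,
      steer_eq_zero (u := fun i => w z (N + i)) fun i _ => hw0 z _ (by omega)] at this
    exact eq_neg_of_add_eq_zero_right this
  refine ⟨s.image fun z => (fun _ => u₀) + w z, ?_, le_trans (Nat.cast_le.2 Finset.card_image_le)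
    hscard, ?_⟩
  · intro u hu i
    obtain ⟨z, hz, rfl⟩ := Finset.mem_image.1 hu
    refine hδO ?_
    rw [Metric.mem_ball, dist_eq_norm, Pi.add_apply, add_sub_cancel_left]
    refine (hwn z i).trans_lt (lt_of_le_of_lt (mul_le_mul_of_nonneg_left ?_ hκ) hρδ)
    rw [norm_neg]
    exact (hM _).trans (mul_le_mul_of_nonneg_left (hsρ z hz) hM0)
  · rintro x ⟨hxu, hxs⟩
    obtain ⟨z, hz, hxz⟩ := hscov ⟨Pu (x - x₀), hmemu _⟩ hxu
    refine ⟨_, Finset.mem_image_of_mem _ hz, ?_⟩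
    have hstate : (a ^ T) x + steer a b T ((fun _ => u₀) + w z) - x₀ =
        (a ^ T) (x - x₀ - z) := by
      have := eq_sub_of_add_eq' (state_equilibrium hx₀ T)
      rw [map_add, hsteer_w, map_sub, map_sub, this]
      abel
    refine ⟨?_, ?_⟩
    · rw [hstate, hPu, projection_pow_comm _ hs.mapsTo_unstable hs.mapsTo_stable, map_sub, ← hPu,
        hPu, Submodule.projection_apply_of_mem_left _ z.2, ← hPu]
      rw [← Submodule.norm_coe, coe_restrict_pow hs] at hxz
      exact hxz
    · rw [hstate, hPs, projection_pow_comm _ hs.mapsTo_stable hs.mapsTo_unstable, map_sub,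
        Submodule.projection_apply_of_mem_right _ z.2, sub_zero, ← hPs]
      exact (hcontr _ (hmems _)).trans (by rwa [one_mul])

theorem exists_iterated_block_controls {O : Set W} (hO : O.Nonempty) {Y : Set V} {T : ℕ}
    {s : Finset (ℕ → W)} (hsO : ∀ u ∈ s, ∀ i, u i ∈ O)
    (hY : ∀ x ∈ Y, ∃ u ∈ s, (a ^ T) x + steer a b T u ∈ Y) (n : ℕ) :
    ∃ t : Finset (ℕ → W), (∀ u ∈ t, ∀ i, u i ∈ O) ∧ t.card ≤ s.card ^ n ∧
      ∀ x ∈ Y, ∃ u ∈ t, (a ^ (n * T)) x + steer a b (n * T) u ∈ Y := by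
  classical
  induction n with
  | zero =>
    obtain ⟨o, ho⟩ := hO
    refine ⟨{fun _ => o}, ?_, by simp, fun x hx => ⟨fun _ => o, by simp, by simpa using hx⟩⟩
    intro u hu i
    rw [Finset.mem_singleton.1 hu]
    exact ho
  | succ n ih =>
    obtain ⟨t, htO, htcard, htY⟩ := ih
    refine ⟨(s ×ˢ t).image fun p => concat T p.1 p.2, ?_, ?_, fun x hx => ?_⟩
    · intro u hu
      obtain ⟨p, hp, rfl⟩ := Finset.mem_image.1 hu
      rw [Finset.mem_product] at hp
      exact concat_mem (hsO _ hp.1) (htO _ hp.2)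
    · refine Finset.card_image_le.trans ?_
      rw [Finset.card_product, pow_succ']
      exact Nat.mul_le_mul_left _ htcard
    · obtain ⟨u, hu, hxu⟩ := hY x hx
      obtain ⟨v, hv, hxv⟩ := htY _ hxu
      refine ⟨_, Finset.mem_image_of_mem _ (Finset.mk_mem_product hu hv), ?_⟩
      rw [Nat.succ_mul, add_comm (n * T) T, state_concat]
      exact hxv

theorem exists_finset_steering_into_nhds [FiniteDimensional ℝ V] {K Y : Set V}
    (hK : IsCompact K) (hKN : K ⊆ nullControllable a b U) {x₀ : V}
    (hx₀ : x₀ ∈ reachableFromZero a b U) (hY : Y ∈ 𝓝 x₀) :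
    ∃ s : Finset (ℕ × (ℕ → W)), (∀ p ∈ s, ∀ i, p.2 i ∈ U) ∧
      ∀ x ∈ K, ∃ p ∈ s, (a ^ p.1) x + steer a b p.1 p.2 ∈ Y := by
  classical
  have hex : ∀ x ∈ K, ∃ p : ℕ × (ℕ → W), (∀ i, p.2 i ∈ U) ∧
      (a ^ p.1) x + steer a b p.1 p.2 = x₀ := by
    intro x hx
    obtain ⟨k, u, hu, h⟩ := hKN hx
    obtain ⟨j, v, hv, rfl⟩ := hx₀
    exact ⟨(k + j, concat k u v), concat_mem hu hv, by rw [state_concat, h]; simp⟩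
  choose! p hpU hp using hex
  obtain ⟨t, htK, ht⟩ := hK.elim_nhds_subcover
    (fun x => {y | (a ^ (p x).1) y + steer a b (p x).1 (p x).2 ∈ Y}) fun x hx => by
      have hcont : Continuous fun y : V => (a ^ (p x).1) y + steer a b (p x).1 (p x).2 :=
        (LinearMap.continuous_of_finiteDimensional _).add continuous_const
      exact hcont.continuousAt.preimage_mem_nhds (by rwa [hp x hx])
  refine ⟨t.image p, fun q hq => ?_, fun x hx => ?_⟩
  · obtain ⟨x, hx, rfl⟩ := Finset.mem_image.1 hq
    exact hpU x (htK x hx)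
  · obtain ⟨y, hy, hxy⟩ := Set.mem_iUnion₂.1 (ht hx)
    exact ⟨p y, Finset.mem_image_of_mem p hy, hxy⟩

/-- Finitely many controls steer all of `K` to the neighbourhood of the equilibrium, after which the
controls for time blocks of length `T` are iterated. Since solutions between points of the control
set do not leave it, only the final state has to be checked. The weight of the initial piece goes
into the constant `C`. -/
theorem spanningWeight_upper_bound [FiniteDimensional ℝ V] (hs : IsHyperbolicSplitting a Eu Es)
    (hF : ∀ x u, F x u = a x + b u) (hc : ∀ y, ∃ k u, steer a b k u = y) {K : Set V}
    (hK : IsCompact K) (hKD : K ⊆ mainControlSet a b U) {x₀ : V} {u₀ : W}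
    (hx₀ : a x₀ + b u₀ = x₀) (hx₀R : x₀ ∈ reachableFromZero a b U)
    (hx₀D : mainControlSet a b U ∈ 𝓝 x₀) {O : Set W} (hO : O ∈ 𝓝 u₀) (hOU : O ⊆ U)
    {f : U → ℝ} {c M : ℝ} (hfc : ∀ u : U, (u : W) ∈ O → f u ≤ c) (hfM : ∀ u, f u ≤ M) :
    ∀ᶠ T : ℕ in atTop, ∃ N : ℕ, 1 ≤ N ∧
      (N : ℝ) ≤ 4 ^ Module.finrank ℝ Eu * |LinearMap.det (a.restrict hs.mapsTo_unstable)| ^ T ∧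
      ∃ C : ℝ, 0 < C ∧ ∀ τ : ℕ, spanningWeight F f τ K (mainControlSet a b U) ≤
        ENNReal.ofReal (C * N ^ (τ / T + 1) * Real.exp (τ * c)) := by
  classical
  obtain ⟨Y, hY, hYD, hblock⟩ := exists_block_controls hs hc hx₀ hO hx₀D
  obtain ⟨P, hPU, hPY⟩ := exists_finset_steering_into_nhds hK
    (hKD.trans Set.inter_subset_right) hx₀R hY
  have hu₀ : u₀ ∈ O := mem_of_mem_nhds hO
  filter_upwards [hblock, eventually_ge_atTop 1] with T hT hT1
  obtain ⟨s, hsO, hscard, hsY⟩ := hT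
  obtain ⟨u₁, hu₁, -⟩ := hsY x₀ (mem_of_mem_nhds hY)
  refine ⟨s.card, Finset.card_pos.2 ⟨u₁, hu₁⟩, hscard, ?_⟩
  set L : ℝ := (P.sup Prod.fst : ℕ) * max (M - c) 0 with hL
  refine ⟨(P.card + 1) * Real.exp L, by positivity, fun τ => ?_⟩
  obtain ⟨t, htO, htcard, htY⟩ := exists_iterated_block_controls ⟨u₀, hu₀⟩ hsO hsY (τ / T + 1)
  have hτ : τ ≤ (τ / T + 1) * T := by
    have h1 := Nat.div_add_mod τ T
    have h2 := Nat.mod_lt τ hT1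
    nlinarith
  set S₀ : Finset (ℕ → W) := (P ×ˢ t).image fun q => concat q.1.1 q.1.2 q.2 with hS₀
  set S : Set (ℕ → U) := {u | (fun i => (u i : W)) ∈ S₀} with hS
  have hspan : IsSpanning F τ K (mainControlSet a b U) S := by
    intro x hx
    obtain ⟨p, hp, hxp⟩ := hPY x hx
    obtain ⟨v, hv, hxv⟩ := htY _ hxp
    have hw : ∀ i, concat p.1 p.2 v i ∈ U := concat_mem (hPU p hp) fun i => hOU (htO v hv i)
    refine ⟨fun i => ⟨_, hw i⟩, ?_, fun k _ hkτ => ?_⟩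
    · exact Finset.mem_image.2 ⟨(p, v), Finset.mk_mem_product hp hv, rfl⟩
    · rw [trajectory_eq hF]
      refine state_mem_mainControlSet_of_le (k := p.1 + (τ / T + 1) * T) hw (hKD hx)
        (by omega) ?_
      rw [state_concat]
      exact hYD hxv
  have hcard : (S.encard : ENNReal) ≤ ((P.card * s.card ^ (τ / T + 1) : ℕ) : ENNReal) := by
    have hinj : Function.Injective fun (u : ℕ → U) (i : ℕ) => (u i : W) := by
      intro u v huv
      funext i
      exact Subtype.ext (congrFun huv i)
    have h1 : S.encard ≤ S₀.card := by
      rw [← hinj.encard_image, ← Set.encard_coe_eq_coe_finsetCard]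
      refine Set.encard_le_encard ?_
      rintro _ ⟨u, hu, rfl⟩
      exact hu
    have h2 : S₀.card ≤ P.card * s.card ^ (τ / T + 1) := by
      refine Finset.card_image_le.trans ?_
      rw [Finset.card_product]
      exact Nat.mul_le_mul_left _ htcard
    have h3 : S.encard ≤ ((P.card * s.card ^ (τ / T + 1) : ℕ) : ℕ∞) :=
      h1.trans (by exact_mod_cast h2)
    calc (S.encard : ENNReal) ≤ (((P.card * s.card ^ (τ / T + 1) : ℕ) : ℕ∞) : ENNReal) :=
          ENat.toENNReal_le.2 h3
      _ = _ := ENat.toENNReal_coe _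
  have hsum : ∀ u ∈ S, ∑ i ∈ Finset.range τ, f (u i) ≤ L + τ * c := by
    intro u hu
    obtain ⟨⟨p, v⟩, hpv, hu'⟩ := Finset.mem_image.1 hu
    obtain ⟨hp, hv⟩ := Finset.mem_product.1 hpv
    have hterm : ∀ i ∈ Finset.range τ,
        f (u i) ≤ (if i < p.1 then max (M - c) 0 else 0) + c := by
      intro i _
      have hi : concat p.1 p.2 v i = u i := congrFun hu' i
      split_ifs with h
      · have h1 := hfM (u i)
        have h2 := le_max_left (M - c) 0
        linarith
      · rw [zero_add]
        refine hfc _ ?_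
        rw [← hi, concat, if_neg h]
        exact htO v hv _
    refine (Finset.sum_le_sum hterm).trans ?_
    rw [Finset.sum_add_distrib, ← Finset.sum_filter, Finset.sum_const, Finset.sum_const,
      Finset.card_range, nsmul_eq_mul, nsmul_eq_mul]
    refine add_le_add (mul_le_mul_of_nonneg_right (Nat.cast_le.2 ?_) (le_max_right _ _)) le_rfl
    refine le_trans (Finset.card_le_card (t := Finset.range p.1) fun i hi => ?_) ?_
    · exact Finset.mem_range.2 (Finset.mem_filter.1 hi).2
    · rw [Finset.card_range]
      exact Finset.le_sup (f := Prod.fst) hp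
  calc spanningWeight F f τ K (mainControlSet a b U)
      ≤ ∑' u : S, ENNReal.ofReal (Real.exp (∑ i ∈ Finset.range τ, f ((u : ℕ → U) i))) :=
        iInf₂_le S hspan
    _ ≤ ∑' _ : S, ENNReal.ofReal (Real.exp (L + τ * c)) := by
        refine ENNReal.tsum_le_tsum fun u => ENNReal.ofReal_le_ofReal (Real.exp_le_exp.2 ?_)
        exact hsum u u.2
    _ = S.encard * ENNReal.ofReal (Real.exp (L + τ * c)) := ENNReal.tsum_set_const _ _
    _ ≤ ((P.card * s.card ^ (τ / T + 1) : ℕ) : ENNReal) *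
          ENNReal.ofReal (Real.exp (L + τ * c)) := by
        gcongr
    _ = ENNReal.ofReal ((P.card * s.card ^ (τ / T + 1) : ℕ) * Real.exp (L + τ * c)) := by
        rw [ENNReal.ofReal_mul (Nat.cast_nonneg _), ENNReal.ofReal_natCast]
    _ ≤ _ := by
        refine ENNReal.ofReal_le_ofReal ?_
        rw [Real.exp_add]
        push_cast
        have : 0 ≤ (s.card : ℝ) ^ (τ / T + 1) * (Real.exp L * Real.exp (τ * c)) := by positivity
        nlinarith

end UpperBound

/-! ### The invariance pressure -/

section Pressure

/-- Exponential lower and upper bounds with rates arbitrarily close to `L` determine the growth rate. -/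
theorem limsup_log_div_eq {w : ℕ → ENNReal} {L : ℝ}
    (hlow : ∃ v : ℝ, 0 < v ∧ ∀ τ : ℕ, 1 ≤ τ → ENNReal.ofReal (v * Real.exp (τ * L)) ≤ w τ)
    (hup : ∀ ε > 0, ∃ C : ℝ, 0 < C ∧ ∀ τ : ℕ, w τ ≤ ENNReal.ofReal (C * Real.exp (τ * (L + ε)))) :
    limsup (fun τ : ℕ => ENNReal.log (w τ) / (τ : EReal)) atTop = L := by
  have hlog : ∀ (C x : ℝ), 0 < C → ∀ τ : ℕ, 1 ≤ τ →
      ENNReal.log (ENNReal.ofReal (C * Real.exp (τ * x))) / (τ : EReal) =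
        ((Real.log C / τ + x : ℝ) : EReal) := by
    intro C x hC τ hτ
    have hτ' : (τ : ℝ) ≠ 0 := by positivity
    rw [ENNReal.log_ofReal_of_pos (by positivity), Real.log_mul hC.ne' (Real.exp_ne_zero _),
      Real.log_exp, ← EReal.coe_coe_eq_natCast, ← EReal.coe_div]
    congr 1
    field_simp
  have hlim : ∀ C : ℝ, Tendsto (fun τ : ℕ => Real.log C / τ) atTop (𝓝 0) := fun C =>
    tendsto_const_nhds.div_atTop tendsto_natCast_atTop_atTop
  refine le_antisymm (EReal.le_of_forall_lt_iff_le.1 fun z hz => ?_)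
    (EReal.ge_of_forall_gt_iff_ge.1 fun z hz => ?_)
  · have hzL : 0 < (z - L) / 2 := by
      have := EReal.coe_lt_coe_iff.1 hz
      linarith
    obtain ⟨C, hC, hw⟩ := hup _ hzL
    refine limsup_le_of_le (by isBoundedDefault) ?_
    filter_upwards [(hlim C).eventually (gt_mem_nhds hzL), eventually_ge_atTop 1] with τ h1 h2
    refine (EReal.div_le_div_right_of_nonneg (by positivity)
      (ENNReal.log_le_log (hw τ))).trans ?_
    rw [hlog C _ hC τ h2, EReal.coe_le_coe_iff]
    linarith
  · obtain ⟨v, hv, hw⟩ := hlow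
    have hzL : z - L < 0 := by
      have := EReal.coe_lt_coe_iff.1 hz
      linarith
    refine le_limsup_of_frequently_le (Eventually.frequently ?_) (by isBoundedDefault)
    filter_upwards [(hlim v).eventually (lt_mem_nhds hzL), eventually_ge_atTop 1] with τ h1 h2
    refine le_trans ?_ (EReal.div_le_div_right_of_nonneg (by positivity)
      (ENNReal.log_le_log (hw τ h2)))
    rw [hlog v _ hv τ h2, EReal.coe_le_coe_iff]
    linarith

theorem invarianceEntropy_eq_invariancePressure_zero {X Ω : Type*} (F : X → Ω → X) (K Q : Set X) :
    invarianceEntropy F K Q = invariancePressure F (fun _ => 0) K Q := by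
  unfold invarianceEntropy invariancePressure spanningNumber spanningWeight
  simp

variable {V W : Type*} [NormedAddCommGroup V] [NormedSpace ℝ V]
  [NormedAddCommGroup W] [NormedSpace ℝ W]
  {a : V →ₗ[ℝ] V} {b : W →ₗ[ℝ] V} {U : Set W} {F : V → U → V} {Eu Es : Submodule ℝ V}

/-- A minimizer `u₁` of `f` may lie on the boundary of `U`. The value `t u₁` with `t < 1` close to `1` is
interior, nearly optimal, and its equilibrium is interior to the control set. -/
theorem exists_near_optimal_equilibrium [FiniteDimensional ℝ V]
    (hs : IsHyperbolicSplitting a Eu Es) (hc : ∀ y, ∃ k u, steer a b k u = y)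
    (hconv : Convex ℝ U) (hU : U ∈ 𝓝 0) (heq : ∀ y, ∃ x, a x + y = x) {f : U → ℝ}
    (hf : Continuous f) (u₁ : U) {c : ℝ} (hc₁ : f u₁ < c) :
    ∃ x₀ u₀, a x₀ + b u₀ = x₀ ∧ x₀ ∈ reachableFromZero a b U ∧ mainControlSet a b U ∈ 𝓝 x₀ ∧
      ∃ O ∈ 𝓝 u₀, O ⊆ U ∧ ∀ u : U, (u : W) ∈ O → f u ≤ c := by
  obtain ⟨x₁, hx₁⟩ := heq (b u₁)
  obtain ⟨G, hG, hGf⟩ := isOpen_induced_iff.1 (hf.isOpen_preimage _ (isOpen_Iio (a := c)))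
  have hmemG : ∀ u : U, (u : W) ∈ G ↔ f u < c := fun u => by
    have : u ∈ Subtype.val ⁻¹' G ↔ u ∈ f ⁻¹' Set.Iio c := by rw [hGf]
    simpa using this
  have hcont : Tendsto (fun t : ℝ => t • (u₁ : W)) (𝓝[<] 1) (𝓝 u₁) := by
    have : Continuous fun t : ℝ => t • (u₁ : W) := by fun_prop
    simpa using (this.tendsto 1).mono_left nhdsWithin_le_nhds
  have hev : ∀ᶠ t : ℝ in 𝓝[<] 1, t ∈ Set.Ioo 0 1 := Ioo_mem_nhdsLT one_pos
  obtain ⟨t, htG, ht0, ht1⟩ :=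
    ((hcont.eventually (hG.mem_nhds ((hmemG u₁).2 hc₁))).and hev).exists
  have hint : t • (u₁ : W) ∈ interior U := by
    have := hconv.combo_interior_closure_mem_interior (mem_interior_iff_mem_nhds.2 hU)
      (subset_closure u₁.2) (sub_pos.2 ht1) ht0.le (by ring)
    simpa using this
  obtain ⟨hR, hN⟩ := smul_equilibrium_mem_interior hs hc hconv hU u₁.2 hx₁ ht0.le ht1
  refine ⟨t • x₁, t • (u₁ : W), ?_, interior_subset hR, ?_, G ∩ interior U,
    (hG.inter isOpen_interior).mem_nhds ⟨htG, hint⟩, fun u hu => interior_subset hu.2,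
    fun u hu => ((hmemG u).1 hu.1).le⟩
  · rw [map_smul, map_smul, ← smul_add, hx₁]
  · exact inter_mem (mem_of_superset (mem_interior_iff_mem_nhds.1 hR) subset_closure)
      (mem_interior_iff_mem_nhds.1 hN)

theorem invariancePressure_mainControlSet [FiniteDimensional ℝ V] [FiniteDimensional ℝ W]
    (hs : IsHyperbolicSplitting a Eu Es) (hF : ∀ x u, F x u = a x + b u)
    (hc : ∀ y, ∃ k u, steer a b k u = y) (hcomp : IsCompact U) (hconv : Convex ℝ U)
    (hU : U ∈ 𝓝 0) (heq : ∀ y, ∃ x, a x + y = x) {K : Set V} (hK : IsCompact K)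
    (hKD : K ⊆ mainControlSet a b U) (hKint : (interior K).Nonempty) {f : U → ℝ}
    (hf : Continuous f) {c : ℝ} (hmin : IsLeast (Set.range f) c) :
    invariancePressure F f K (mainControlSet a b U) =
      ((Real.log |LinearMap.det (a.restrict hs.mapsTo_unstable)| + c : ℝ) : EReal) := by
  set q : ℝ := |LinearMap.det (a.restrict hs.mapsTo_unstable)| with hq
  have hq0 : 0 < q := abs_pos.2 (det_restrict_unstable_ne_zero hs)
  have hqpow : ∀ n : ℕ, q ^ n = Real.exp (n * Real.log q) := fun n => by
    rw [Real.exp_nat_mul, Real.exp_log hq0]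
  refine limsup_log_div_eq ?_ fun ε hε => ?_
  · obtain ⟨v, hv, h⟩ := exists_card_lower_bound hs hF hKD
      (isBounded_mainControlSet hs hcomp.isBounded (mem_of_mem_nhds hU)) hKint
    refine ⟨v, hv, fun τ hτ => le_trans (le_of_eq ?_)
      (spanningWeight_lower_bound (fun u => hmin.2 ⟨u, rfl⟩) (h τ hτ))⟩
    rw [← hq, hqpow, mul_assoc, ← Real.exp_add]
    ring_nf
  · obtain ⟨u₁, hu₁⟩ := hmin.1
    have : CompactSpace U := isCompact_iff_compactSpace.1 hcomp
    obtain ⟨M, hM⟩ := (isCompact_range hf).bddAbove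
    obtain ⟨x₀, u₀, hx₀, hx₀R, hx₀D, O, hO, hOU, hfO⟩ := exists_near_optimal_equilibrium
      (c := c + ε / 2) hs hc hconv hU heq hf u₁ (by linarith)
    have hlim : Tendsto (fun T : ℕ => Module.finrank ℝ Eu * Real.log 4 / (T : ℝ)) atTop (𝓝 0) :=
      tendsto_const_nhds.div_atTop tendsto_natCast_atTop_atTop
    obtain ⟨T, ⟨N, hN1, hNT, C, hC, hw⟩, hT, hT1⟩ :=
      ((spanningWeight_upper_bound hs hF hc hK hKD hx₀ hx₀R hx₀D hO hOU hfO
        (fun u => hM ⟨u, rfl⟩)).and ((hlim.eventually (gt_mem_nhds (half_pos hε))).and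
        (eventually_ge_atTop 1))).exists
    have hN0 : (0 : ℝ) < N := by exact_mod_cast hN1
    have hT0 : (0 : ℝ) < T := by exact_mod_cast hT1
    have hlogN : Real.log N ≤ T * (Real.log q + ε / 2) := by
      have h1 := Real.log_le_log hN0 hNT
      rw [← hq, Real.log_mul (by positivity) (by positivity), Real.log_pow, Real.log_pow] at h1
      rw [div_lt_iff₀ hT0] at hT
      linarith
    have hlogN0 : 0 ≤ Real.log N := Real.log_nonneg (by exact_mod_cast hN1)
    refine ⟨C * N, by positivity, fun τ => (hw τ).trans (ENNReal.ofReal_le_ofReal ?_)⟩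
    have hpow : (N : ℝ) ^ (τ / T) ≤ Real.exp (τ * (Real.log q + ε / 2)) := by
      rw [← Real.exp_log hN0, ← Real.exp_nat_mul, Real.exp_le_exp]
      have h1 : ((τ / T : ℕ) : ℝ) ≤ τ / T := Nat.cast_div_le
      calc ((τ / T : ℕ) : ℝ) * Real.log N ≤ τ / T * (T * (Real.log q + ε / 2)) :=
            mul_le_mul h1 hlogN hlogN0 (by positivity)
        _ = _ := by field_simp
    calc C * N ^ (τ / T + 1) * Real.exp (τ * (c + ε / 2))
        = C * N * (N ^ (τ / T) * Real.exp (τ * (c + ε / 2))) := by ring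
      _ ≤ C * N * (Real.exp (τ * (Real.log q + ε / 2)) * Real.exp (τ * (c + ε / 2))) := by
          gcongr
      _ = _ := by
          rw [← Real.exp_add]
          ring_nf

end Pressure

end DiscreteControl

open DiscreteControl

theorem theorem6p4 (d m : ℕ)
    (A : Matrix (Fin d) (Fin d) ℝ) (B : Matrix (Fin d) (Fin m) ℝ) (U : Set (Fin m → ℝ))
    (hA : IsUnit A)
    (hU_compact : IsCompact U) (hU_convex : Convex ℝ U) (hU_nhds : U ∈ 𝓝 (0 : Fin m → ℝ))
    (hU_closure : U = closure (interior U))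
    (hcontr : DiscreteControl.IsControllable (DiscreteControl.linearSystem A B))
    (hhyp : DiscreteControl.IsHyperbolic A) :
    (∃! D : Set (Fin d → ℝ),
      DiscreteControl.IsControlSet (DiscreteControl.constrainedLinearSystem A B U) D ∧
        (interior D).Nonempty) ∧
    ∀ D : Set (Fin d → ℝ),
      DiscreteControl.IsControlSet (DiscreteControl.constrainedLinearSystem A B U) D →
      (interior D).Nonempty →
      Bornology.IsBounded D ∧
      ∀ K : Set (Fin d → ℝ), K ⊆ D → IsCompact K → (interior K).Nonempty →
        DiscreteControl.IsAdmissiblePair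
          (DiscreteControl.constrainedLinearSystem A B U) K D ∧
        ∀ f : C(U, ℝ), ∃ c : ℝ, IsLeast (Set.range f) c ∧
          DiscreteControl.invariancePressure
              (DiscreteControl.constrainedLinearSystem A B U) f K D
            = ((Real.log |DiscreteControl.unstableDet A| : ℝ) : EReal) + (c : EReal) ∧
          DiscreteControl.invariancePressure
              (DiscreteControl.constrainedLinearSystem A B U) f K D
            = DiscreteControl.invarianceEntropy
                (DiscreteControl.constrainedLinearSystem A B U) K D + (c : EReal) := by
  set a := Matrix.toLin' A with ha
  set b := Matrix.toLin' B with hb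
  set F := constrainedLinearSystem A B U with hFdef
  have hF : ∀ x u, F x u = a x + b u := fun x u => rfl
  have hs : IsHyperbolicSplitting a (unstableSubspace A) (stableSubspace A) :=
    isHyperbolicSplitting hA hhyp
  have hc : ∀ y, ∃ k u, steer a b k u = y := by
    intro y
    obtain ⟨k, -, u, hu⟩ := hcontr 0 y
    refine ⟨k, u, ?_⟩
    rw [← hu]
    clear hu
    induction k with
    | zero => rfl
    | succ k ih => rw [steer_succ, ih]; rfl
  have h0 : (0 : Fin m → ℝ) ∈ U := mem_of_mem_nhds hU_nhds
  have hDint : (interior (mainControlSet a b U)).Nonempty :=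
    ⟨0, mem_interior_iff_mem_nhds.2 (mainControlSet_mem_nhds_zero hc hU_nhds)⟩
  have huniq : ∀ D, IsControlSet F D → (interior D).Nonempty → D = mainControlSet a b U :=
    fun D hD hint => hD.eq_mainControlSet hs hF hc hU_convex hU_nhds hint
  refine ⟨⟨mainControlSet a b U, ⟨isControlSet_mainControlSet hF hc hU_nhds, hDint⟩,
    fun D hD => huniq D hD.1 hD.2⟩, fun D hD hint => ?_⟩
  obtain rfl := huniq D hD hint
  refine ⟨isBounded_mainControlSet hs hU_compact.isBounded h0, fun K hKD hK hKint => ⟨?_, ?_⟩⟩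
  · exact ⟨hKint.mono interior_subset, hint.mono interior_subset, hKD, hK,
      fun x hx => hD.prop.2.2 x (hKD hx)⟩
  · intro f
    have : CompactSpace U := isCompact_iff_compactSpace.1 hU_compact
    have : Nonempty U := ⟨⟨0, h0⟩⟩
    obtain ⟨c, hcmin⟩ := (isCompact_range f.continuous).exists_isLeast (Set.range_nonempty f)
    have hpress : ∀ {g : U → ℝ}, Continuous g → ∀ {c : ℝ}, IsLeast (Set.range g) c →
        invariancePressure F g K (mainControlSet a b U) =
          ((Real.log |unstableDet A| + c : ℝ) : EReal) := fun hg c hmin =>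
      invariancePressure_mainControlSet hs hF hc hU_compact hU_convex hU_nhds
        (exists_equilibrium hhyp) hK hKD hKint hg hmin
    have hzero : IsLeast (Set.range fun _ : U => (0 : ℝ)) 0 := by
      rw [Set.range_const]
      exact isLeast_singleton
    refine ⟨c, hcmin, ?_, ?_⟩
    · rw [hpress f.continuous hcmin, EReal.coe_add]
    · rw [hpress f.continuous hcmin, invarianceEntropy_eq_invariancePressure_zero,
        hpress continuous_const hzero, add_zero, EReal.coe_add]
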